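/- Let $\mathbb T=\mathbb R/\mathbb Z=[0,1)$ and let $W:\mathbb R\to\mathbb R$ be strictly increasing and right continuous (with left limits), with $W(u+1)-W(u)=W(1)-W(0)$ for all $u$; write $W(dy)$ for the measure with $W((a,b])=W(b)-W(a)$. **The operator.** Let $\mathfrak D_W\subset L^2(\mathbb T)$ be the set of $G$ with $G(u)=\alpha+\beta W(u)+\int_{(0,u]}\big(\int_0^y g(z)\,dz\big)W(dy)$ for $u\in[0,1)$, for some $\alpha,\beta\in\mathbb R$ and $g\in L^2(\mathbb T)$ such that $\int_0^1 g\,dz=0$ and $\int_{(0,1]}\big(\beta+\int_0^y g(z)\,dz\big)W(dy)=0$, and put $\mathfrak L_WG=g$. For $G\in\mathfrak D_W$ (extended $1$-periodically) let $\partial_WG(u)=\lim_{\varepsilon\to0}\frac{G(u+\varepsilon)-G(u)}{W(u+\varepsilon)-W(u)}$. **Test functions.** Let $\varphi_1,\varphi_2,\dots$ be a complete orthonormal basis of $L^2(\mathbb T)$ of eigenfunctions of $-\mathfrak L_W$, listed so that their eigenvalues $\mu_1\le\mu_2\le\cdots$ are nondecreasing, let $\|f\|_n^2=\sum_{k\ge1}(1+\mu_k)^{2n}k^{2n}\langle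 f,\varphi_k\rangle_{L^2}^2$, and let $S_W(\mathbb T)$ be the space of $f\in L^2(\mathbb T)$ with $\|f\|_n<\infty$ for all $n\ge 0$ (it does not depend on the choice of the basis). Let $S_W'(\mathbb T)$ be its dual, i.e. the linear functionals on $S_W(\mathbb T)$ bounded by a multiple of some $\|\cdot\|_n$. **The process.** Let $b>-1/2$, $\rho\in[0,1]$, $\chi(\rho)=\rho(1-\rho)$ and $\tilde c'(\rho)=1+2b\rho$. On a filtered probability space let $\{\mathcal B_t:t\ge0\}$ be an $S_W'(\mathbb T)$-valued Brownian motion with quadratic variation $\langle\mathcal B(H)\rangle_t=t\int_{\mathbb T}(\partial_WH(x))^2\,W(dx)$, and let $\{\mathcal Y_t:t\ge0\}$ be an adapted, càdlàg, $S_W'(\mathbb T)$-valued solution of $$d\mathcal Y_t=\tilde c'(\rho)\,\mathfrak L_W\mathcal Y_t\,dt+\sqrt{2\chi(\rho)\tilde c'(\rho)}\,d\mathcal B_t ,$$ that is, for each $H\in S_W(\mathbb T)$, almost surely, $\mathcal Y_t(H)=\mathcal Y_0(H)+\tilde c'(\rho)\int_0^t\mathcal Y_r(\mathfrak L_WH)\,dr+\sqrt{2\chi(\rho)\tilde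 c'(\rho)}\,\mathcal B_t(H)$ for all $t\ge0$. Assume that it starts from equilibrium: $\mathcal Y_0(H)$ is a centred Gaussian variable with variance $\chi(\rho)\int_{\mathbb T}H(u)^2\,du$ for each $H\in S_W(\mathbb T)$. **Lemma.** Let $\{P_t:t\ge0\}$ be the strongly continuous semigroup on $L^2(\mathbb T)$ with generator $\tilde c'(\rho)\mathfrak L_W$. Then for all $H\in S_W(\mathbb T)$ and all $0\le s\le t$, the variable $\mathcal Y_t(H)\mathcal Y_s(H)$ is integrable and $$\mathbb E\big[\mathcal Y_t(H)\mathcal Y_s(H)\big]=\chi(\rho)\int_{\mathbb T}(P_{t-s}H)(u)\,H(u)\,du .$$ -/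

import Mathlib

open MeasureTheory ProbabilityTheory Set Filter Topology
open scoped NNReal

noncomputable section

/-- Lebesgue measure on the torus `𝕋 = ℝ/ℤ = [0,1)`. -/
abbrev torusMeasure : Measure ℝ := volume.restrict (Ico (0 : ℝ) 1)

/-- The real Hilbert space `L²(𝕋)`. -/
abbrev L2T : Type := Lp ℝ 2 torusMeasure

/-- `G : ℝ → ℝ` is (the 1-periodic extension of) a function in the domain `𝔇_W`, and `g ∈ L²(𝕋)`
is the function attached to it: on `[0,1)`,
`G(u) = a + b W(u) + ∫_{(0,u]} (∫_0^y g(z) dz) W(dy)`, where `∫_0^1 g = 0` and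
`∫_{(0,1]} (b + ∫_0^y g(z) dz) W(dy) = 0`.
Here `W.measure` is the measure with `W((a,b]) = W(b) - W(a)`. -/
structure IsDomainFunction (W : StieltjesFunction ℝ) (G : ℝ → ℝ) (g : L2T) : Prop where
  periodic : Function.Periodic G 1
  integral_eq_zero : ∫ z in (0 : ℝ)..1, g z = 0
  exists_repr : ∃ a b : ℝ,
    (∀ u ∈ Ico (0 : ℝ) 1,
      G u = a + b * W u + ∫ y in Ioc 0 u, (∫ z in (0 : ℝ)..y, g z) ∂W.measure) ∧
    ∫ y in Ioc (0 : ℝ) 1, (b + ∫ z in (0 : ℝ)..y, g z) ∂W.measure = 0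

/-- The graph of the operator `𝔏_W : 𝔇_W ⊆ L²(𝕋) → L²(𝕋)`:
`IsLW W F g` says that `F ∈ 𝔇_W` and `𝔏_W F = g`. -/
def IsLW (W : StieltjesFunction ℝ) (F g : L2T) : Prop :=
  ∃ G : ℝ → ℝ, IsDomainFunction W G g ∧ F =ᵐ[torusMeasure] G

/-- The generalized derivative
`∂_W G(u) = lim_{ε → 0} (G(u+ε) - G(u)) / (W(u+ε) - W(u))`. -/
def wDeriv (W : StieltjesFunction ℝ) (G : ℝ → ℝ) (u : ℝ) : ℝ :=
  limUnder (𝓝[≠] (0 : ℝ)) fun ε => (G (u + ε) - G u) / (W (u + ε) - W u)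

/-- `∫_𝕋 (∂_W G(x))² W(dx)`. -/
def wEnergy (W : StieltjesFunction ℝ) (G : ℝ → ℝ) : ℝ :=
  ∫ x in Ioc (0 : ℝ) 1, (wDeriv W G x) ^ 2 ∂W.measure

/-- `φ₀, φ₁, …` is a complete orthonormal basis of `L²(𝕋)` consisting of eigenfunctions of
`-𝔏_W`, with eigenvalues `μ₀ ≤ μ₁ ≤ …`. -/
structure IsEigenbasis (W : StieltjesFunction ℝ) (φ : HilbertBasis ℕ ℝ L2T) (μ : ℕ → ℝ) :
    Prop where
  mono : Monotone μ
  eigen : ∀ k, IsLW W (φ k) (-(μ k) • φ k)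

/-- The `k`-th term of `⟨f, f⟩ₙ = ∑ₖ (1 + μₖ)^{2n} k^{2n} ∫ (P_k f)²`, where `P_k` is the orthogonal
projection onto the line spanned by the `k`-th eigenfunction. The basis is indexed from `0`, so the
position of `φ k` in the list of eigenfunctions is `k + 1`. -/
def sobolevTerm (φ : HilbertBasis ℕ ℝ L2T) (μ : ℕ → ℝ) (n : ℕ) (f : L2T) (k : ℕ) : ℝ :=
  (1 + μ k) ^ (2 * n) * ((k : ℝ) + 1) ^ (2 * n) * (inner ℝ (φ k) f) ^ 2

/-- The norm `‖f‖ₙ = ⟨f, f⟩ₙ^{1/2}`. -/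
def sobolevNorm (φ : HilbertBasis ℕ ℝ L2T) (μ : ℕ → ℝ) (n : ℕ) (f : L2T) : ℝ :=
  Real.sqrt (∑' k, sobolevTerm φ μ n f k)

/-- `⋂ₙ Sₙ` for a given basis of eigenfunctions, where `Sₙ = {f ∈ L²(𝕋) : ‖f‖ₙ < ∞}`. -/
def smoothSpace (φ : HilbertBasis ℕ ℝ L2T) (μ : ℕ → ℝ) : Submodule ℝ L2T where
  carrier := {f | ∀ n, Summable (sobolevTerm φ μ n f)}
  zero_mem' := by
    intro n
    have : sobolevTerm φ μ n 0 = 0 := by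
      funext k
      simp [sobolevTerm]
    rw [this]
    exact summable_zero
  add_mem' := by
    intro f g hf hg n
    refine Summable.of_nonneg_of_le (fun k => ?_) (fun k => ?_)
      (((hf n).add (hg n)).mul_left 2)
    · have h1 := (even_two_mul n).pow_nonneg (1 + μ k)
      have h2 := (even_two_mul n).pow_nonneg ((k : ℝ) + 1)
      unfold sobolevTerm
      positivity
    · have h1 := (even_two_mul n).pow_nonneg (1 + μ k)
      have h2 := (even_two_mul n).pow_nonneg ((k : ℝ) + 1)
      have h3 := mul_nonneg h1 h2
      have h4 : (inner ℝ (φ k) f + inner ℝ (φ k) g) ^ 2 ≤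
          2 * ((inner ℝ (φ k) f) ^ 2 + (inner ℝ (φ k) g) ^ 2) := by
        nlinarith [sq_nonneg ((inner ℝ (φ k) f : ℝ) - inner ℝ (φ k) g)]
      have h5 := mul_le_mul_of_nonneg_left h4 h3
      simp only [sobolevTerm, inner_add_right]
      linarith
  smul_mem' := by
    intro c f hf n
    have : sobolevTerm φ μ n (c • f) = fun k => c ^ 2 * sobolevTerm φ μ n f k := by
      funext k
      simp only [sobolevTerm, inner_smul_right]
      ring
    rw [this]
    exact (hf n).mul_left _

/-- The space of test functions `S_W(𝕋) = ⋂ₙ Sₙ`. The eigenfunctions are only determined up to a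
rotation inside the finite-dimensional eigenspaces; the space is the same for all choices, and we
take the supremum over all of them in order not to single one out. -/
def testSpace (W : StieltjesFunction ℝ) : Submodule ℝ L2T :=
  ⨆ (φ : HilbertBasis ℕ ℝ L2T) (μ : ℕ → ℝ) (_ : IsEigenbasis W φ μ), smoothSpace φ μ

/-- Membership in the dual space `S'_W(𝕋)`: a linear functional on `S_W(𝕋)` is bounded if it is
bounded by a multiple of one of the norms `‖·‖ₙ`. -/
def IsBoundedFunctional (W : StieltjesFunction ℝ) (l : testSpace W →ₗ[ℝ] ℝ) : Prop :=
  ∀ (φ : HilbertBasis ℕ ℝ L2T) (μ : ℕ → ℝ), IsEigenbasis W φ μ →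
    ∃ (n : ℕ) (C : ℝ), ∀ f : testSpace W, (f : L2T) ∈ smoothSpace φ μ →
      |l f| ≤ C * sobolevNorm φ μ n f

/-- A function of time is càdlàg. -/
def IsCadlag (x : ℝ≥0 → ℝ) : Prop :=
  ∀ t, ContinuousWithinAt x (Ici t) t ∧ ∃ l, Tendsto x (𝓝[<] t) (𝓝 l)

/-- `B` is an `S'_W(𝕋)`-valued Brownian motion with respect to the filtration `ℱ`, with quadratic
variation `⟨B(H)⟩_t = t ∫_𝕋 (∂_W H(x))² W(dx)`. -/
structure IsSWBrownian (W : StieltjesFunction ℝ) {Ω : Type*} {mΩ : MeasurableSpace Ω}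
    (Pr : Measure Ω) (ℱ : Filtration ℝ≥0 mΩ) (B : ℝ≥0 → Ω → testSpace W →ₗ[ℝ] ℝ) : Prop where
  bounded : ∀ t ω, IsBoundedFunctional W (B t ω)
  adapted : ∀ t H, Measurable[ℱ t] fun ω => B t ω H
  continuous_paths : ∀ ω H, Continuous fun t => B t ω H
  zero : ∀ ω H, B 0 ω H = 0
  indep_increments : ∀ s t, s ≤ t → ∀ H,
    Indep (MeasurableSpace.comap (fun ω => B t ω H - B s ω H) inferInstance) (ℱ s) Pr
  increments_law : ∀ s t, s ≤ t → ∀ (H : testSpace W) (G : ℝ → ℝ) (g : L2T),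
    IsDomainFunction W G g → (H : L2T) =ᵐ[torusMeasure] G →
    HasLaw (fun ω => B t ω H - B s ω H)
      (gaussianReal 0 (((t : ℝ) - s) * wEnergy W G).toNNReal) Pr

/-- `Y` is a solution, with trajectories in `D([0,∞), S'_W(𝕋))`, of the equation
`dY_t = a 𝔏_W Y_t dt + σ dB_t`, tested against functions in `S_W(𝕋)`; here `(𝔏_W Y)(H)` means
`Y(𝔏_W H)`. -/
structure IsOUSolution (W : StieltjesFunction ℝ) (a σ : ℝ) {Ω : Type*} {mΩ : MeasurableSpace Ω}
    (Pr : Measure Ω) (ℱ : Filtration ℝ≥0 mΩ) (B Y : ℝ≥0 → Ω → testSpace W →ₗ[ℝ] ℝ) : Prop where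
  brownian : IsSWBrownian W Pr ℱ B
  bounded : ∀ t ω, IsBoundedFunctional W (Y t ω)
  adapted : ∀ t H, Measurable[ℱ t] fun ω => Y t ω H
  cadlag_paths : ∀ ω H, IsCadlag fun t => Y t ω H
  equation : ∀ H K : testSpace W, IsLW W H K → ∀ᵐ ω ∂Pr, ∀ t : ℝ≥0,
    Y t ω H = Y 0 ω H + a * (∫ r in (0 : ℝ)..t, Y r.toNNReal ω K) + σ * B t ω H

/-- `P` is the strongly continuous semigroup on `L²(𝕋)` associated to `a 𝔏_W`, that is, the one
whose infinitesimal generator is `a 𝔏_W` (with domain `𝔇_W`). -/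
structure IsSemigroupOf (W : StieltjesFunction ℝ) (a : ℝ) (P : ℝ≥0 → L2T →L[ℝ] L2T) : Prop where
  zero : P 0 = ContinuousLinearMap.id ℝ L2T
  add : ∀ s t, P (s + t) = (P s).comp (P t)
  continuous : ∀ f, Continuous fun t => P t f
  generator : ∀ f g : L2T,
    Tendsto (fun t : ℝ≥0 => (t : ℝ)⁻¹ • (P t f - f)) (𝓝[>] 0) (𝓝 g) ↔
      ∃ h, IsLW W f h ∧ g = a • h

end

/-!
# Covariances of the stationary Ornstein–Uhlenbeck process driven by `𝔏_W`

Tested against an eigenfunction `ψ` with `𝔏_W ψ = -λ ψ`, the equation for `Y` is the scalar linear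
equation `dX = -aλ X dt + σ dB(ψ)`. Variation of constants gives
`X_t = e^{-aλt} X_0 + σ ∫_0^t e^{-aλ(t-r)} dB_r(ψ)`, and since the integrand is deterministic and
smooth, the stochastic integral is defined pathwise through integration by parts (`ouConv`); no Itô
calculus is needed, and all second moments follow from Fubini's theorem.

Two facts about `𝔏_W` make the covariances stationary. Integration by parts, which is Fubini's
theorem on a triangle for `du ⊗ W(dy)`, gives `⟨F, 𝔏_W F'⟩ = -∫ ∂_W F ∂_W F' dW`
(`inner_eq_neg_integral_wDeriv`), because `∂_W` of an element of the domain is exactly the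
continuous function that is integrated against `W(dy)` in its representation (`wDeriv_eq_flux`).
Hence `𝔏_W` is symmetric, `Cov(B_t(ψ), B_t(ψ')) = t λ' ⟨ψ, ψ'⟩`, and nonorthogonal
eigenfunctions have equal eigenvalues. With `σ² = 2χa` the variance `χ` is then preserved, so
`E[Y_s(ψ) Y_s(ψ')] = χ ⟨ψ, ψ'⟩` (`IsOUSolution.integral_mul_self`). The martingale property of
`B(ψ)` adds the factor `e^{-aλ(t-s)}` between times `s` and `t`, which is the action of `P_{t-s}`
on `ψ` (`IsSemigroupOf.apply_eigenfunction`).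

The formula extends bilinearly to the span of the eigenfunctions, and then to all test functions:
a smooth function is the limit of its eigenfunction expansion in every Sobolev norm, hence under
each `Y_t(ω)` (`approximable_eq_top`), and Fatou's lemma upgrades the identity
`E[Y_t(f)²] = χ ‖f‖²` on the span to the bound `E[Y_t(H)²] ≤ χ ‖H‖²` for all `H`
(`IsOUSolution.eLpNorm_le`), so that both sides of the formula are continuous in `H`. Working with
eigenfunctions of arbitrary bases at once makes it unnecessary to know that the space of test
functions is the same for all bases.
-/

noncomputable section

/-! ### The energy identity for `𝔏_W` -/

/-- `y ↦ β + ∫_0^y g(z) dz`, the function whose integral against `W(dy)` is an element of `𝔇_W`. -/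
def flux (β : ℝ) (g : L2T) (y : ℝ) : ℝ := β + ∫ z in (0 : ℝ)..y, g z

lemma L2T.integrable (g : L2T) : Integrable (fun z => g z) torusMeasure :=
  (Lp.memLp g).integrable (by norm_num)

lemma L2T.integrableOn_Ioc (g : L2T) : IntegrableOn (fun z => g z) (Ioc 0 1) volume := by
  have h : IntegrableOn (fun z => g z) (Ico 0 1) volume := L2T.integrable g
  exact ((integrableOn_Icc_iff_integrableOn_Ico (by simp)).mpr h).mono_set Ioc_subset_Icc_self

lemma L2T.intervalIntegrable (g : L2T) {u v : ℝ} (hu : u ∈ Icc (0 : ℝ) 1) (hv : v ∈ Icc (0 : ℝ) 1) :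
    IntervalIntegrable (fun z => g z) volume u v := by
  have h : IntervalIntegrable (fun z => g z) volume 0 1 := by
    rw [intervalIntegrable_iff_integrableOn_Ioc_of_le zero_le_one]
    exact L2T.integrableOn_Ioc g
  refine h.mono_set ?_
  rw [uIcc_of_le (zero_le_one' ℝ)]
  exact uIcc_subset_Icc hu hv

lemma continuousOn_flux (β : ℝ) (g : L2T) : ContinuousOn (flux β g) (Icc 0 1) := by
  have h := intervalIntegral.continuousOn_primitive_interval' (μ := volume) (f := fun z => g z)
    (L2T.intervalIntegrable g (left_mem_Icc.mpr zero_le_one) (right_mem_Icc.mpr zero_le_one))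
    (a := 0) left_mem_uIcc
  rw [uIcc_of_le (zero_le_one' ℝ)] at h
  exact continuousOn_const.add h

lemma integrableOn_flux (W : StieltjesFunction ℝ) (β : ℝ) (g : L2T) {s : Set ℝ}
    (hs : s ⊆ Icc 0 1) : IntegrableOn (flux β g) s W.measure :=
  ((continuousOn_flux β g).integrableOn_Icc).mono_set hs

lemma integrableOn_primitive (W : StieltjesFunction ℝ) (g : L2T) {u : ℝ} (hu : u ≤ 1) :
    IntegrableOn (fun y => ∫ z in (0 : ℝ)..y, g z) (Ioc 0 u) W.measure := by
  have h := integrableOn_flux W 0 g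
    (Ioc_subset_Icc_self.trans (Icc_subset_Icc_right hu) : Ioc 0 u ⊆ Icc 0 1)
  have h0 : flux 0 g = fun y => ∫ z in (0 : ℝ)..y, g z := funext fun y => zero_add _
  rwa [h0] at h

/-- The representation of `G` by its flux holds on the closed interval `[0,1]`: at `u = 1` it says
`G 1 = G 0`, since the total flux vanishes. -/
lemma IsDomainFunction.exists_flux {W : StieltjesFunction ℝ} {G : ℝ → ℝ} {g : L2T}
    (h : IsDomainFunction W G g) : ∃ β : ℝ,
      (∀ u ∈ Icc (0 : ℝ) 1, G u = G 0 + ∫ y in Ioc 0 u, flux β g y ∂W.measure) ∧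
      ∫ y in Ioc (0 : ℝ) 1, flux β g y ∂W.measure = 0 ∧ flux β g 1 = flux β g 0 := by
  obtain ⟨α, β, hG, hβ⟩ := h.exists_repr
  refine ⟨β, ?_, hβ, ?_⟩
  · intro u hu
    rcases eq_or_lt_of_le hu.2 with rfl | hu1
    · have h1 : G 1 = G 0 := by simpa using h.periodic 0
      have h2 : ∫ y in Ioc (0 : ℝ) 1, flux β g y ∂W.measure = 0 := hβ
      rw [h1, h2, add_zero]
    · have hint := integrableOn_primitive W g hu.2
      have h0 := hG 0 ⟨le_rfl, zero_lt_one⟩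
      rw [hG u ⟨hu.1, hu1⟩, h0]
      unfold flux
      have hreal : W.measure.real (Ioc 0 u) = W u - W 0 := by
        rw [Measure.real, W.measure_Ioc, ENNReal.toReal_ofReal (sub_nonneg.mpr (W.mono hu.1))]
      have hconst : IntegrableOn (fun _ : ℝ => β) (Ioc 0 u) W.measure :=
        integrableOn_const (by simp [W.measure_Ioc])
      rw [integral_add hconst hint, setIntegral_const, hreal, Ioc_self, setIntegral_empty,
        smul_eq_mul]
      ring
  · simp [flux, h.integral_eq_zero]

/-- Averages over shrinking intervals `(u, u + ε]` converge under right continuity. -/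
lemma tendsto_average_right {W : StieltjesFunction ℝ} (hW : StrictMono W) {f : ℝ → ℝ} {u v : ℝ}
    (huv : u < v) (hf : ContinuousOn f (Icc u v)) :
    Tendsto (fun ε => (∫ y in Ioc u (u + ε), f y ∂W.measure) / (W (u + ε) - W u))
      (𝓝[>] 0) (𝓝 (f u)) := by
  rw [Metric.tendsto_nhds]
  intro δ hδ
  have hc := hf u (left_mem_Icc.mpr huv.le)
  rw [Metric.continuousWithinAt_iff] at hc
  obtain ⟨η, hη, hc⟩ := hc (δ / 2) (by positivity)
  filter_upwards [Ioo_mem_nhdsGT (lt_min hη (sub_pos.mpr huv))] with ε hε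
  obtain ⟨hε0, hε1⟩ := hε
  have hεη := hε1.trans_le (min_le_left _ _)
  have hεv := hε1.trans_le (min_le_right _ _)
  have hpos : 0 < W (u + ε) - W u := sub_pos.mpr (hW (by linarith))
  have hint : IntegrableOn f (Ioc u (u + ε)) W.measure :=
    hf.integrableOn_Icc.mono_set (Ioc_subset_Icc_self.trans (Icc_subset_Icc_right (by linarith)))
  have hreal : W.measure.real (Ioc u (u + ε)) = W (u + ε) - W u := by
    rw [Measure.real, W.measure_Ioc, ENNReal.toReal_ofReal hpos.le]
  have key : |(∫ y in Ioc u (u + ε), f y ∂W.measure) - f u * (W (u + ε) - W u)| ≤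
      δ / 2 * (W (u + ε) - W u) := by
    have : (∫ y in Ioc u (u + ε), f y ∂W.measure) - f u * (W (u + ε) - W u) =
        ∫ y in Ioc u (u + ε), (f y - f u) ∂W.measure := by
      rw [integral_sub hint (integrableOn_const (by simp [W.measure_Ioc]))]
      simp [hreal, mul_comm]
    rw [this, ← hreal, ← Real.norm_eq_abs]
    refine norm_setIntegral_le_of_norm_le_const (by simp [W.measure_Ioc]) ?_
    intro y hy
    have := hc (x := y) ⟨hy.1.le, by linarith [hy.2]⟩ (by
      rw [Real.dist_eq, abs_of_pos (by linarith [hy.1])]; linarith [hy.2])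
    rw [Real.dist_eq] at this
    exact this.le
  rw [Real.dist_eq, div_sub' hpos.ne', abs_div, abs_of_pos hpos, div_lt_iff₀ hpos, mul_comm _ (f u)]
  nlinarith

/-- Averages over shrinking intervals `(u + ε, u]`, `ε < 0`, converge under left continuity; an atom
of `W` at `u` does no harm, since it carries the value `f u`. -/
lemma tendsto_average_left {W : StieltjesFunction ℝ} (hW : StrictMono W) {f : ℝ → ℝ} {u v : ℝ}
    (huv : v < u) (hf : ContinuousOn f (Icc v u)) :
    Tendsto (fun ε => (-∫ y in Ioc (u + ε) u, f y ∂W.measure) / (W (u + ε) - W u))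
      (𝓝[<] 0) (𝓝 (f u)) := by
  rw [Metric.tendsto_nhds]
  intro δ hδ
  have hc := hf u (right_mem_Icc.mpr huv.le)
  rw [Metric.continuousWithinAt_iff] at hc
  obtain ⟨η, hη, hc⟩ := hc (δ / 2) (by positivity)
  have hneg : max (-η) (v - u) < 0 := max_lt (by linarith) (by linarith)
  filter_upwards [Ioo_mem_nhdsLT hneg] with ε hε
  obtain ⟨hε1, hε0⟩ := hε
  have hεη := (le_max_left _ _).trans_lt hε1
  have hεv := (le_max_right _ _).trans_lt hε1
  have hpos : 0 < W u - W (u + ε) := sub_pos.mpr (hW (by linarith))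
  have hint : IntegrableOn f (Ioc (u + ε) u) W.measure :=
    hf.integrableOn_Icc.mono_set (Ioc_subset_Icc_self.trans (Icc_subset_Icc_left (by linarith)))
  have hreal : W.measure.real (Ioc (u + ε) u) = W u - W (u + ε) := by
    rw [Measure.real, W.measure_Ioc, ENNReal.toReal_ofReal hpos.le]
  have key : |(∫ y in Ioc (u + ε) u, f y ∂W.measure) - f u * (W u - W (u + ε))| ≤
      δ / 2 * (W u - W (u + ε)) := by
    have : (∫ y in Ioc (u + ε) u, f y ∂W.measure) - f u * (W u - W (u + ε)) =
        ∫ y in Ioc (u + ε) u, (f y - f u) ∂W.measure := by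
      rw [integral_sub hint (integrableOn_const (by simp [W.measure_Ioc]))]
      simp [hreal, mul_comm]
    rw [this, ← hreal, ← Real.norm_eq_abs]
    refine norm_setIntegral_le_of_norm_le_const (by simp [W.measure_Ioc]) ?_
    intro y hy
    have := hc (x := y) ⟨by linarith [hy.1], hy.2⟩ (by
      rw [Real.dist_eq, abs_sub_comm, abs_of_nonneg (by linarith [hy.2])]; linarith [hy.1])
    rw [Real.dist_eq] at this
    exact this.le
  have hsign : (-∫ y in Ioc (u + ε) u, f y ∂W.measure) / (W (u + ε) - W u) =
      (∫ y in Ioc (u + ε) u, f y ∂W.measure) / (W u - W (u + ε)) := by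
    rw [← neg_sub (W u), neg_div_neg_eq]
  rw [hsign, Real.dist_eq, div_sub' hpos.ne', abs_div, abs_of_pos hpos, div_lt_iff₀ hpos,
    mul_comm _ (f u)]
  nlinarith

/-- `∂_W G` is the flux of `G`. At `u = 1` the difference quotients from the right are those of the
periodic extension at `0`, and the fluxes at `0` and `1` agree because `∫_0^1 g = 0`. -/
lemma wDeriv_eq_flux {W : StieltjesFunction ℝ} (hW : StrictMono W)
    (hper : ∀ u : ℝ, W (u + 1) - W u = W 1 - W 0) {G : ℝ → ℝ} {g : L2T}
    (hp : Function.Periodic G 1) {β : ℝ}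
    (hG : ∀ u ∈ Icc (0 : ℝ) 1, G u = G 0 + ∫ y in Ioc 0 u, flux β g y ∂W.measure)
    (h01 : flux β g 1 = flux β g 0) {u : ℝ} (hu : u ∈ Ioc (0 : ℝ) 1) :
    wDeriv W G u = flux β g u := by
  have hdiff : ∀ v w : ℝ, 0 ≤ v → v ≤ w → w ≤ 1 →
      G w - G v = ∫ y in Ioc v w, flux β g y ∂W.measure := by
    intro v w hv hvw hw
    rw [hG v ⟨hv, hvw.trans hw⟩, hG w ⟨hv.trans hvw, hw⟩, ← Ioc_union_Ioc_eq_Ioc hv hvw,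
      setIntegral_union (Ioc_disjoint_Ioc_of_le le_rfl) measurableSet_Ioc]
    · ring
    · exact integrableOn_flux W β g (Ioc_subset_Icc_self.trans (Icc_subset_Icc_right (hvw.trans hw)))
    · exact integrableOn_flux W β g (Ioc_subset_Icc_self.trans (Icc_subset_Icc hv hw))
  have hright : Tendsto (fun ε => (G (u + ε) - G u) / (W (u + ε) - W u)) (𝓝[>] 0)
      (𝓝 (flux β g u)) := by
    rcases eq_or_lt_of_le hu.2 with rfl | hu1
    · rw [h01]
      refine (tendsto_average_right hW zero_lt_one (continuousOn_flux β g)).congr' ?_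
      filter_upwards [Ioo_mem_nhdsGT (zero_lt_one' ℝ)] with ε hε
      have h1 : G (1 + ε) = G ε := by rw [add_comm]; exact hp ε
      have h2 : G 1 = G 0 := by simpa using hp 0
      have h3 : W (1 + ε) - W 1 = W ε - W 0 := by
        have := hper ε
        rw [add_comm] at this
        linarith
      rw [h1, h2, h3, hdiff 0 ε le_rfl hε.1.le hε.2.le, zero_add]
    · refine (tendsto_average_right hW hu1
        ((continuousOn_flux β g).mono (Icc_subset_Icc_left hu.1.le))).congr' ?_
      filter_upwards [Ioo_mem_nhdsGT (sub_pos.mpr hu1)] with ε hε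
      rw [hdiff u (u + ε) hu.1.le (by linarith [hε.1]) (by linarith [hε.2])]
  have hleft : Tendsto (fun ε => (G (u + ε) - G u) / (W (u + ε) - W u)) (𝓝[<] 0)
      (𝓝 (flux β g u)) := by
    refine (tendsto_average_left hW hu.1
      ((continuousOn_flux β g).mono (Icc_subset_Icc_right hu.2))).congr' ?_
    filter_upwards [Ioo_mem_nhdsLT (neg_lt_zero.mpr hu.1)] with ε hε
    rw [← hdiff (u + ε) u (by linarith [hε.1]) (by linarith [hε.2]) hu.2, neg_sub]
  have : Tendsto (fun ε => (G (u + ε) - G u) / (W (u + ε) - W u)) (𝓝[≠] 0)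
      (𝓝 (flux β g u)) := by
    rw [← Iio_union_Ioi, nhdsWithin_union]
    exact hleft.sup hright
  exact this.limUnder_eq

lemma integral_Ioc_eq_flux_sub (β : ℝ) (g : L2T) (hg : ∫ z in (0 : ℝ)..1, g z = 0) {y : ℝ}
    (hy : y ∈ Icc (0 : ℝ) 1) : ∫ z in Ioc y 1, g z = β - flux β g y := by
  have := intervalIntegral.integral_add_adjacent_intervals
    (L2T.intervalIntegrable g (left_mem_Icc.mpr zero_le_one) hy)
    (L2T.intervalIntegrable g hy (right_mem_Icc.mpr zero_le_one))
  rw [← intervalIntegral.integral_of_le hy.2, flux]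
  linarith

/-- Integration by parts for the representation of `𝔇_W`, by Fubini's theorem on the triangle
`0 < y ≤ u ≤ 1`. -/
lemma integral_mul_eq_neg_integral_flux {W : StieltjesFunction ℝ} {G : ℝ → ℝ} {g g' : L2T}
    {β β' : ℝ} (hG : ∀ u ∈ Icc (0 : ℝ) 1, G u = G 0 + ∫ y in Ioc 0 u, flux β g y ∂W.measure)
    (hβ : ∫ y in Ioc (0 : ℝ) 1, flux β g y ∂W.measure = 0)
    (hg' : ∫ z in (0 : ℝ)..1, g' z = 0) :
    ∫ u in Ico (0 : ℝ) 1, G u * g' u =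
      -∫ y in Ioc (0 : ℝ) 1, flux β g y * flux β' g' y ∂W.measure := by
  set ν := W.measure.restrict (Ioc (0 : ℝ) 1) with hν
  set m := (volume : Measure ℝ).restrict (Ioc (0 : ℝ) 1) with hm
  have hfin : IsFiniteMeasure ν := ⟨by simp [hν, W.measure_Ioc]⟩
  have hfl : Integrable (flux β g) ν := integrableOn_flux W β g Ioc_subset_Icc_self
  have hfl' : ContinuousOn (flux β' g') (Icc 0 1) := continuousOn_flux β' g'
  have hgi : Integrable (fun z => g' z) m := L2T.integrableOn_Ioc g'
  have hprod : Integrable (fun p : ℝ × ℝ =>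
      {p : ℝ × ℝ | p.2 ≤ p.1}.indicator (fun p => g' p.1 * flux β g p.2) p) (m.prod ν) :=
    (hgi.mul_prod hfl).indicator (measurableSet_le measurable_snd measurable_fst)
  have hswap := integral_integral_swap (μ := m) (ν := ν) (f := fun u y =>
    {p : ℝ × ℝ | p.2 ≤ p.1}.indicator (fun p => g' p.1 * flux β g p.2) (u, y)) hprod
  have h1 : ∀ u ∈ Ioc (0 : ℝ) 1,
      ∫ y, {p : ℝ × ℝ | p.2 ≤ p.1}.indicator (fun p => g' p.1 * flux β g p.2) (u, y) ∂ν =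
        (G u - G 0) * g' u := by
    intro u hu
    have : ∀ y, {p : ℝ × ℝ | p.2 ≤ p.1}.indicator (fun p => g' p.1 * flux β g p.2) (u, y) =
        (Iic u).indicator (fun y => g' u * flux β g y) y := by
      intro y; simp [indicator_apply]
    simp_rw [this]
    rw [integral_indicator measurableSet_Iic, hν, Measure.restrict_restrict measurableSet_Iic,
      integral_const_mul, inter_comm, Ioc_inter_Iic, min_eq_right hu.2,
      hG u ⟨hu.1.le, hu.2⟩]
    ring
  have h2 : ∀ y ∈ Ioc (0 : ℝ) 1,
      ∫ u, {p : ℝ × ℝ | p.2 ≤ p.1}.indicator (fun p => g' p.1 * flux β g p.2) (u, y) ∂m =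
        flux β g y * β' - flux β g y * flux β' g' y := by
    intro y hy
    have : ∀ u, {p : ℝ × ℝ | p.2 ≤ p.1}.indicator (fun p => g' p.1 * flux β g p.2) (u, y) =
        (Ici y).indicator (fun u => g' u * flux β g y) u := by
      intro u; simp [indicator_apply]
    simp_rw [this]
    have hI : Ici y ∩ Ioc 0 1 = Icc y 1 := by
      ext z
      simp only [mem_inter_iff, mem_Ici, mem_Ioc, mem_Icc]
      exact ⟨fun h => ⟨h.1, h.2.2⟩, fun h => ⟨h.1, hy.1.trans_le h.1, h.2⟩⟩
    rw [integral_indicator measurableSet_Ici, hm, Measure.restrict_restrict measurableSet_Ici,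
      integral_mul_const, hI, integral_Icc_eq_integral_Ioc,
      integral_Ioc_eq_flux_sub β' g' hg' ⟨hy.1.le, hy.2⟩]
    ring
  have hg0 : ∫ u, g' u ∂m = 0 := by
    rw [hm, ← intervalIntegral.integral_of_le zero_le_one, hg']
  rw [setIntegral_congr_fun measurableSet_Ioc h1, setIntegral_congr_fun measurableSet_Ioc h2]
    at hswap
  have hff : Integrable (fun y => flux β g y * flux β' g' y) ν :=
    (((continuousOn_flux β g).mul hfl').integrableOn_Icc (μ := W.measure)).mono_set
      Ioc_subset_Icc_self
  rw [integral_sub (hfl.mul_const β') hff, integral_mul_const, hβ, zero_mul, zero_sub] at hswap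
  rw [← hswap, integral_Ico_eq_integral_Ioo, ← integral_Ioc_eq_integral_Ioo]
  -- `u ↦ ∫_{(0,u]} flux dW` need not be continuous; its measurability comes from Fubini.
  have hGg : Integrable (fun u => (G u - G 0) * g' u) m := by
    refine hprod.integral_prod_left.congr ?_
    filter_upwards [ae_restrict_mem measurableSet_Ioc] with u hu using h1 u hu
  have : ∀ u, G u * g' u = (G u - G 0) * g' u + G 0 * g' u := fun u => by ring
  simp_rw [this]
  rw [integral_add hGg (hgi.const_mul _), integral_const_mul, hg0, mul_zero, add_zero]

/-- `⟨G, 𝔏_W G'⟩ = -∫_𝕋 ∂_W G ∂_W G' dW`. -/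
lemma inner_eq_neg_integral_wDeriv {W : StieltjesFunction ℝ} (hW : StrictMono W)
    (hper : ∀ u : ℝ, W (u + 1) - W u = W 1 - W 0) {G G' : ℝ → ℝ} {F g g' : L2T}
    (h : IsDomainFunction W G g) (h' : IsDomainFunction W G' g') (hF : F =ᵐ[torusMeasure] G) :
    inner ℝ F g' = -∫ y in Ioc (0 : ℝ) 1, wDeriv W G y * wDeriv W G' y ∂W.measure := by
  obtain ⟨β, hG, hβ, h01⟩ := h.exists_flux
  obtain ⟨β', hG', hβ', h01'⟩ := h'.exists_flux
  have h1 : ∫ y in Ioc (0 : ℝ) 1, wDeriv W G y * wDeriv W G' y ∂W.measure =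
      ∫ y in Ioc (0 : ℝ) 1, flux β g y * flux β' g' y ∂W.measure :=
    setIntegral_congr_fun measurableSet_Ioc fun y hy => by
      simp only [wDeriv_eq_flux hW hper h.periodic hG h01 hy,
        wDeriv_eq_flux hW hper h'.periodic hG' h01' hy]
  rw [h1, ← integral_mul_eq_neg_integral_flux hG hβ h'.integral_eq_zero, L2.inner_def]
  refine integral_congr_ae ?_
  filter_upwards [hF] with u hu
  simp [hu, mul_comm]

/-- The operator `𝔏_W` is symmetric. -/
lemma IsLW.inner_comm {W : StieltjesFunction ℝ} (hW : StrictMono W)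
    (hper : ∀ u : ℝ, W (u + 1) - W u = W 1 - W 0) {F F' g g' : L2T} (h : IsLW W F g)
    (h' : IsLW W F' g') : inner ℝ F g' = inner ℝ F' g := by
  obtain ⟨G, hG, hF⟩ := h
  obtain ⟨G', hG', hF'⟩ := h'
  rw [inner_eq_neg_integral_wDeriv hW hper hG hG' hF,
    inner_eq_neg_integral_wDeriv hW hper hG' hG hF']
  simp_rw [mul_comm]

lemma wEnergy_eq {W : StieltjesFunction ℝ} (hW : StrictMono W)
    (hper : ∀ u : ℝ, W (u + 1) - W u = W 1 - W 0) {G : ℝ → ℝ} {F g : L2T}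
    (h : IsDomainFunction W G g) (hF : F =ᵐ[torusMeasure] G) : wEnergy W G = -inner ℝ F g := by
  rw [inner_eq_neg_integral_wDeriv hW hper h h hF, neg_neg, wEnergy]
  simp_rw [sq]

lemma wEnergy_nonneg (W : StieltjesFunction ℝ) (G : ℝ → ℝ) : 0 ≤ wEnergy W G :=
  integral_nonneg fun _ => sq_nonneg _

lemma IsDomainFunction.add {W : StieltjesFunction ℝ} {G G' : ℝ → ℝ} {g g' : L2T}
    (h : IsDomainFunction W G g) (h' : IsDomainFunction W G' g') :
    IsDomainFunction W (G + G') (g + g') := by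
  have hadd : ∀ y ∈ Icc (0 : ℝ) 1, ∫ z in (0 : ℝ)..y, (g + g' : L2T) z =
      (∫ z in (0 : ℝ)..y, g z) + ∫ z in (0 : ℝ)..y, g' z := by
    intro y hy
    rw [← intervalIntegral.integral_add
      (L2T.intervalIntegrable g (left_mem_Icc.mpr zero_le_one) hy)
      (L2T.intervalIntegrable g' (left_mem_Icc.mpr zero_le_one) hy),
      intervalIntegral.integral_of_le hy.1, intervalIntegral.integral_of_le hy.1]
    have h1 : (fun z => (g + g' : L2T) z) =ᵐ[volume.restrict (Icc (0 : ℝ) 1)]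
        fun z => g z + g' z := by
      rw [← restrict_Ico_eq_restrict_Icc]
      exact Lp.coeFn_add g g'
    exact integral_congr_ae (ae_restrict_of_ae_restrict_of_subset
      (Ioc_subset_Icc_self.trans (Icc_subset_Icc_right hy.2)) h1)
  obtain ⟨α, β, hG, hβ⟩ := h.exists_repr
  obtain ⟨α', β', hG', hβ'⟩ := h'.exists_repr
  refine ⟨h.periodic.add h'.periodic, ?_, α + α', β + β', ?_, ?_⟩
  · rw [hadd 1 (right_mem_Icc.mpr zero_le_one), h.integral_eq_zero, h'.integral_eq_zero, add_zero]
  · intro u hu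
    have : ∫ y in Ioc 0 u, (∫ z in (0 : ℝ)..y, (g + g' : L2T) z) ∂W.measure =
        ∫ y in Ioc 0 u, ((∫ z in (0 : ℝ)..y, g z) + ∫ z in (0 : ℝ)..y, g' z) ∂W.measure :=
      setIntegral_congr_fun measurableSet_Ioc fun y hy => hadd y ⟨hy.1.le, hy.2.trans hu.2.le⟩
    rw [this, integral_add (integrableOn_primitive W g hu.2.le)
      (integrableOn_primitive W g' hu.2.le), Pi.add_apply, hG u hu, hG' u hu]
    ring
  · have : ∫ y in Ioc (0 : ℝ) 1, (β + β' + ∫ z in (0 : ℝ)..y, (g + g' : L2T) z) ∂W.measure =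
        ∫ y in Ioc (0 : ℝ) 1, (flux β g y + flux β' g' y) ∂W.measure :=
      setIntegral_congr_fun measurableSet_Ioc fun y hy => by
        simp only [hadd y ⟨hy.1.le, hy.2⟩, flux]; ring
    rw [this, integral_add (integrableOn_flux W β g Ioc_subset_Icc_self)
      (integrableOn_flux W β' g' Ioc_subset_Icc_self)]
    simp only [flux, hβ, hβ', add_zero]

/-! ### Càdlàg solutions of the scalar linear equation -/

lemma measurable_of_rightContinuous {y : ℝ → ℝ} (hy : ∀ t, ContinuousWithinAt y (Ici t) t) :
    Measurable y := by
  -- `y` is the pointwise limit of its values on the grids `ℤ / (n + 1)`, approached from the right.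
  refine measurable_of_tendsto_metrizable
    (f := fun (n : ℕ) (t : ℝ) => y ((⌊((n : ℝ) + 1) * t⌋ + 1 : ℝ) / ((n : ℝ) + 1))) ?_ ?_
  · intro n
    have h : Measurable fun k : ℤ => y (((k : ℝ) + 1) / ((n : ℝ) + 1)) := measurable_from_top
    exact h.comp (Int.measurable_floor.comp (measurable_const.mul measurable_id))
  · rw [tendsto_pi_nhds]
    intro t
    refine (hy t).tendsto.comp (tendsto_nhdsWithin_iff.mpr ⟨?_, ?_⟩)
    · have hlim : Tendsto (fun n : ℕ => t + 1 / ((n : ℝ) + 1)) atTop (𝓝 t) := by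
        simpa using tendsto_const_nhds.add (tendsto_one_div_add_atTop_nhds_zero_nat (𝕜 := ℝ))
      refine tendsto_of_tendsto_of_tendsto_of_le_of_le tendsto_const_nhds hlim ?_ ?_
      · intro n
        have hn : (0 : ℝ) < n + 1 := by positivity
        simp only
        rw [le_div_iff₀ hn]
        linarith [Int.lt_floor_add_one (((n : ℝ) + 1) * t)]
      · intro n
        have hn : (0 : ℝ) < n + 1 := by positivity
        simp only
        have h1 : (t + 1 / ((n : ℝ) + 1)) * (n + 1) = ((n : ℝ) + 1) * t + 1 := by
          field_simp
        rw [div_le_iff₀ hn, h1]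
        linarith [Int.floor_le (((n : ℝ) + 1) * t)]
    · refine Eventually.of_forall fun n => ?_
      have hn : (0 : ℝ) < n + 1 := by positivity
      rw [mem_Ici, le_div_iff₀ hn]
      linarith [Int.lt_floor_add_one (((n : ℝ) + 1) * t)]

lemma exists_bound_of_cadlag {y : ℝ → ℝ} (hr : ∀ t, ContinuousWithinAt y (Ici t) t)
    (hl : ∀ t, ∃ l, Tendsto y (𝓝[<] t) (𝓝 l)) (T : ℝ) : ∃ C, ∀ t ∈ Icc 0 T, |y t| ≤ C := by
  refine isCompact_Icc.induction_on (p := fun s => ∃ C, ∀ t ∈ s, |y t| ≤ C) ⟨0, by simp⟩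
    (fun s t hst ⟨C, hC⟩ => ⟨C, fun u hu => hC u (hst hu)⟩)
    (fun s t ⟨C, hC⟩ ⟨D, hD⟩ => ⟨max C D, fun u hu => hu.elim
      (fun h => (hC u h).trans (le_max_left _ _)) fun h => (hD u h).trans (le_max_right _ _)⟩) ?_
  intro t _
  obtain ⟨l, hl⟩ := hl t
  have h1 : ∀ᶠ u in 𝓝[≥] t, |y u| < |y t| + 1 :=
    (hr t).abs.tendsto.eventually (gt_mem_nhds (lt_add_one _))
  have h2 : ∀ᶠ u in 𝓝[<] t, |y u| < |l| + 1 := hl.abs.eventually (gt_mem_nhds (lt_add_one _))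
  refine ⟨{u | |y u| ≤ max (|y t| + 1) (|l| + 1)}, mem_nhdsWithin_of_mem_nhds ?_, _, fun u hu => hu⟩
  rw [← nhdsLT_sup_nhdsGE]
  refine mem_sup.mpr ⟨?_, ?_⟩
  · filter_upwards [h2] with u hu using hu.le.trans (le_max_right _ _)
  · filter_upwards [h1] with u hu using hu.le.trans (le_max_left _ _)

lemma IsCadlag.intervalIntegrable {x : ℝ≥0 → ℝ} (hx : IsCadlag x) {T : ℝ} (hT : 0 ≤ T) :
    IntervalIntegrable (fun r : ℝ => x r.toNNReal) volume 0 T := by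
  have hr : ∀ t, ContinuousWithinAt (fun r : ℝ => x r.toNNReal) (Ici t) t := fun t =>
    (hx t.toNNReal).1.comp continuous_real_toNNReal.continuousWithinAt
      fun u hu => Real.toNNReal_le_toNNReal hu
  have hl : ∀ t, ∃ l, Tendsto (fun r : ℝ => x r.toNNReal) (𝓝[<] t) (𝓝 l) := by
    intro t
    rcases le_or_gt t 0 with ht | ht
    · refine ⟨x 0, tendsto_const_nhds.congr' ?_⟩
      filter_upwards [self_mem_nhdsWithin] with u hu
      rw [Real.toNNReal_of_nonpos ((le_of_lt hu).trans ht)]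
    · obtain ⟨l, hl⟩ := (hx t.toNNReal).2
      refine ⟨l, hl.comp (tendsto_nhdsWithin_iff.mpr
        ⟨continuous_real_toNNReal.continuousAt.mono_left nhdsWithin_le_nhds, ?_⟩)⟩
      filter_upwards [self_mem_nhdsWithin] with u hu
      exact (Real.toNNReal_lt_toNNReal_iff ht).mpr hu
  obtain ⟨C, hC⟩ := exists_bound_of_cadlag hr hl T
  rw [intervalIntegrable_iff_integrableOn_Ioc_of_le hT]
  refine Measure.integrableOn_of_bounded (M := C) (by simp)
    (measurable_of_rightContinuous hr).aestronglyMeasurable ?_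
  filter_upwards [ae_restrict_mem measurableSet_Ioc] with t ht using hC t ⟨ht.1.le, ht.2⟩

/-- `m(t) - κ ∫_0^t e^{-κ(t-r)} m(r) dr`, which is `∫_0^t e^{-κ(t-r)} dm(r)` after integration
by parts when `m(0) = 0`. -/
def ouConv (κ : ℝ) (m : ℝ≥0 → ℝ) (t : ℝ) : ℝ :=
  m t.toNNReal - κ * ∫ r in (0 : ℝ)..t, Real.exp (-κ * (t - r)) * m r.toNNReal

/-- A càdlàg path with `x(t) = x(0) - κ ∫_0^t x(r) dr + σ m(t)` is given by the variation of
constants formula. -/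
lemma IsCadlag.eq_exp_mul_add_ouConv {x m : ℝ≥0 → ℝ} (hx : IsCadlag x) (hm : Continuous m)
    {κ σ : ℝ} (h : ∀ t : ℝ≥0, x t = x 0 - κ * (∫ r in (0 : ℝ)..t, x r.toNNReal) + σ * m t)
    (t : ℝ≥0) : x t = Real.exp (-κ * t) * x 0 + σ * ouConv κ m t := by
  set I : ℝ → ℝ := fun t => ∫ r in (0 : ℝ)..t, x r.toNNReal with hI
  have hmr : Continuous fun r : ℝ => m r.toNNReal := hm.comp continuous_real_toNNReal
  have ht0 : (0 : ℝ) ≤ t := t.2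
  have hIc : ContinuousOn I (Icc 0 t) := by
    have := intervalIntegral.continuousOn_primitive_interval' (hx.intervalIntegrable ht0)
      (a := 0) left_mem_uIcc
    rwa [uIcc_of_le ht0] at this
  have hxI : ∀ r : ℝ, 0 ≤ r → x r.toNNReal = x 0 - κ * I r + σ * m r.toNNReal := by
    intro r hr
    have := h r.toNNReal
    rwa [Real.coe_toNNReal r hr] at this
  have hxc : ContinuousOn (fun r : ℝ => x r.toNNReal) (Icc 0 t) :=
    ContinuousOn.congr (((continuousOn_const (c := x 0)).sub (hIc.const_mul κ)).add
      (hmr.continuousOn.const_mul σ)) fun r hr => hxI r hr.1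
  have hderiv : ∀ r ∈ Ioo (0 : ℝ) t, HasDerivAt (fun r => Real.exp (κ * r) * I r)
      (Real.exp (κ * r) * (x 0 + σ * m r.toNNReal)) r := by
    intro r hr
    have hnhds : Icc (0 : ℝ) t ∈ 𝓝 r := Icc_mem_nhds hr.1 hr.2
    have h1 : HasDerivAt I (x r.toNNReal) r := by
      refine intervalIntegral.integral_hasDerivAt_right
        (hx.intervalIntegrable hr.1.le) ?_ (hxc.continuousAt hnhds)
      exact hxc.stronglyMeasurableAtFilter_nhdsWithin measurableSet_Icc r |>.filter_mono
        (by rw [nhdsWithin_eq_nhds.mpr hnhds])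
    have h2 : HasDerivAt (fun r => Real.exp (κ * r)) (Real.exp (κ * r) * κ) r := by
      simpa using ((hasDerivAt_id r).const_mul κ).exp
    convert! h2.mul h1 using 1
    rw [hxI r hr.1.le]
    ring
  have hFTC := intervalIntegral.integral_eq_sub_of_hasDerivAt_of_le ht0
    ((Real.continuous_exp.comp (continuous_const.mul continuous_id)).continuousOn.mul hIc) hderiv
    ((Continuous.intervalIntegrable (by fun_prop) _ _))
  have hI0 : I 0 = 0 := by simp [hI]
  have hexp : ∫ r in (0 : ℝ)..t, Real.exp (κ * r) * κ = Real.exp (κ * t) - 1 := by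
    have : ∀ r ∈ uIcc (0 : ℝ) t, HasDerivAt (fun r => Real.exp (κ * r)) (Real.exp (κ * r) * κ) r :=
      fun r _ => by simpa using ((hasDerivAt_id r).const_mul κ).exp
    rw [intervalIntegral.integral_eq_sub_of_hasDerivAt this
      (Continuous.intervalIntegrable (by fun_prop) _ _)]
    simp
  have hsplit : κ * ∫ r in (0 : ℝ)..t, Real.exp (κ * r) * (x 0 + σ * m r.toNNReal) =
      x 0 * (Real.exp (κ * t) - 1) +
        σ * κ * ∫ r in (0 : ℝ)..t, Real.exp (κ * r) * m r.toNNReal := by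
    rw [← hexp, ← intervalIntegral.integral_const_mul, ← intervalIntegral.integral_const_mul,
      ← intervalIntegral.integral_const_mul, ← intervalIntegral.integral_add
        (Continuous.intervalIntegrable (by fun_prop) _ _)
        (Continuous.intervalIntegrable (by fun_prop) _ _)]
    congr 1
    funext r
    ring
  have hconv : ∫ r in (0 : ℝ)..t, Real.exp (-κ * (t - r)) * m r.toNNReal =
      Real.exp (-κ * t) * ∫ r in (0 : ℝ)..t, Real.exp (κ * r) * m r.toNNReal := by
    rw [← intervalIntegral.integral_const_mul]
    congr 1
    funext r
    rw [← mul_assoc, ← Real.exp_add]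
    congr 2
    ring
  have hee : Real.exp (-κ * t) * Real.exp (κ * t) = 1 := by
    rw [← Real.exp_add]; simp
  have h1 := h t
  rw [ouConv, hconv, Real.toNNReal_coe, h1]
  rw [hFTC] at hsplit
  simp only [Pi.mul_apply, Function.comp_apply, id_eq, hI0, mul_zero, sub_zero] at hsplit
  change x 0 - κ * I t + σ * m t = _
  have hIt : κ * I t = Real.exp (-κ * t) * (κ * (Real.exp (κ * t) * I t)) := by
    linear_combination (-κ * I t) * hee
  rw [hIt, hsplit]
  linear_combination (-x 0) * hee

/-! ### Stochastic convolutions and their second moments -/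

lemma ouConv_congr {κ t : ℝ} (ht : 0 ≤ t) {m m' : ℝ≥0 → ℝ}
    (h : ∀ r : ℝ, 0 ≤ r → r ≤ t → m r.toNNReal = m' r.toNNReal) : ouConv κ m t = ouConv κ m' t := by
  unfold ouConv
  rw [h t ht le_rfl]
  congr 2
  refine intervalIntegral.integral_congr fun r hr => ?_
  rw [uIcc_of_le ht] at hr
  simp only [h r hr.1 hr.2]

/-- The integral against `dm` picks up nothing after a time from which `m` is constant. -/
lemma ouConv_eq_exp_mul {κ : ℝ} {c : ℝ≥0 → ℝ} {s t : ℝ≥0} (hst : s ≤ t)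
    (hc : ∀ r, s ≤ r → c r = c s)
    (hi : IntervalIntegrable (fun r : ℝ => c r.toNNReal) volume 0 s) :
    ouConv κ c t = Real.exp (-κ * (t - s)) * ouConv κ c s := by
  have hst' : (s : ℝ) ≤ t := hst
  have hexp : κ * ∫ r in (s : ℝ)..t, Real.exp (-κ * (t - r)) =
      1 - Real.exp (-κ * (t - s)) := by
    have : ∀ r ∈ uIcc (s : ℝ) t, HasDerivAt (fun r => Real.exp (-κ * (t - r)))
        (κ * Real.exp (-κ * (t - r))) r := by
      intro r _
      have h1 : HasDerivAt (fun r : ℝ => -κ * (t - r)) κ r := by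
        simpa using ((hasDerivAt_id r).const_sub (t : ℝ)).const_mul (-κ)
      simpa [mul_comm] using h1.exp
    rw [← intervalIntegral.integral_const_mul, intervalIntegral.integral_eq_sub_of_hasDerivAt this
      (Continuous.intervalIntegrable (by fun_prop) _ _)]
    simp
  have h1 : ∫ r in (s : ℝ)..t, Real.exp (-κ * (t - r)) * c r.toNNReal =
      (∫ r in (s : ℝ)..t, Real.exp (-κ * (t - r))) * c s := by
    rw [← intervalIntegral.integral_mul_const]
    refine intervalIntegral.integral_congr fun r hr => ?_
    rw [uIcc_of_le hst'] at hr
    simp only [hc r.toNNReal (NNReal.le_toNNReal_of_coe_le hr.1)]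
  have h2 : ∫ r in (0 : ℝ)..s, Real.exp (-κ * (t - r)) * c r.toNNReal =
      Real.exp (-κ * (t - s)) * ∫ r in (0 : ℝ)..s, Real.exp (-κ * (s - r)) * c r.toNNReal := by
    rw [← intervalIntegral.integral_const_mul]
    congr 1
    funext r
    rw [← mul_assoc, ← Real.exp_add]
    congr 2
    ring
  have hi1 : IntervalIntegrable (fun r : ℝ => Real.exp (-κ * (t - r)) * c r.toNNReal) volume 0 s :=
    hi.continuousOn_mul (Continuous.continuousOn (by fun_prop))
  have hi2 : IntervalIntegrable (fun r : ℝ => Real.exp (-κ * (t - r)) * c r.toNNReal) volume s t := by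
    have : IntervalIntegrable (fun r : ℝ => Real.exp (-κ * (t - r)) * c s) volume s t :=
      Continuous.intervalIntegrable (by fun_prop) _ _
    refine this.congr ?_
    intro r hr
    rw [uIoc_of_le hst'] at hr
    simp only [hc r.toNNReal (NNReal.le_toNNReal_of_coe_le hr.1.le)]
  unfold ouConv
  rw [← intervalIntegral.integral_add_adjacent_intervals hi1 hi2, h1, h2, Real.toNNReal_coe,
    Real.toNNReal_coe, hc t hst]
  linear_combination (-c s) * hexp

/-- The value of `∫_0^t e^{-κ(t-r)} e dr`. -/
lemma ouConv_linear {κ : ℝ} (hκ : κ ≠ 0) (e : ℝ) {t : ℝ} (ht : 0 ≤ t) :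
    ouConv κ (fun q => (q : ℝ) * e) t = e * ((1 - Real.exp (-κ * t)) / κ) := by
  have hd : ∀ r ∈ uIcc (0 : ℝ) t, HasDerivAt
      (fun r => Real.exp (-κ * (t - r)) * (r / κ - 1 / κ ^ 2) * e)
      (Real.exp (-κ * (t - r)) * (r * e)) r := by
    intro r _
    have h1 : HasDerivAt (fun r : ℝ => -κ * (t - r)) κ r := by
      simpa using ((hasDerivAt_id r).const_sub (t : ℝ)).const_mul (-κ)
    have h2 : HasDerivAt (fun r : ℝ => r / κ - 1 / κ ^ 2) (1 / κ) r := by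
      simpa using ((hasDerivAt_id r).div_const κ).sub_const (1 / κ ^ 2)
    convert! (h1.exp.mul h2).mul_const e using 1
    field_simp
    ring
  have h1 : ∫ r in (0 : ℝ)..t, Real.exp (-κ * (t - r)) * ((r.toNNReal : ℝ) * e) =
      ∫ r in (0 : ℝ)..t, Real.exp (-κ * (t - r)) * (r * e) := by
    refine intervalIntegral.integral_congr fun r hr => ?_
    rw [uIcc_of_le ht] at hr
    simp only [Real.coe_toNNReal r hr.1]
  rw [ouConv, h1, intervalIntegral.integral_eq_sub_of_hasDerivAt hd
    (Continuous.intervalIntegrable (by fun_prop) _ _), Real.coe_toNNReal t ht]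
  simp only [sub_self, mul_zero, Real.exp_zero, sub_zero, zero_div, zero_sub]
  field_simp
  ring

/-- The value of `∫_0^t e^{-2κ(t-r)} e dr`, in the iterated form in which it arises as the second
moment of a stochastic convolution. -/
lemma ouConv_exp_mul_ouConv_linear {κ : ℝ} (hκ : κ ≠ 0) (e : ℝ) {t : ℝ} (ht : 0 ≤ t) :
    ouConv κ (fun r => Real.exp (-κ * (t - r)) * ouConv κ (fun q => (q : ℝ) * e) r) t =
      e * ((1 - Real.exp (-(2 * κ) * t)) / (2 * κ)) := by
  have hd : ∀ r ∈ uIcc (0 : ℝ) t, HasDerivAt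
      (fun r => e / κ ^ 2 * (Real.exp (-(2 * κ) * (t - r)) / 2 - Real.exp (-κ * (2 * t - r))))
      (Real.exp (-κ * (t - r)) *
        (Real.exp (-κ * (t - r)) * (e * ((1 - Real.exp (-κ * r)) / κ)))) r := by
    intro r _
    have h1 : HasDerivAt (fun r : ℝ => -(2 * κ) * (t - r)) (2 * κ) r := by
      simpa using ((hasDerivAt_id r).const_sub (t : ℝ)).const_mul (-(2 * κ))
    have h2 : HasDerivAt (fun r : ℝ => -κ * (2 * t - r)) κ r := by
      simpa using ((hasDerivAt_id r).const_sub (2 * t)).const_mul (-κ)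
    convert! ((h1.exp.div_const 2).sub h2.exp).const_mul (e / κ ^ 2) using 1
    have e1 : Real.exp (-(2 * κ) * (t - r)) = Real.exp (-κ * (t - r)) * Real.exp (-κ * (t - r)) := by
      rw [← Real.exp_add]; congr 1; ring
    have e2 : Real.exp (-κ * (2 * t - r)) =
        Real.exp (-κ * (t - r)) * Real.exp (-κ * (t - r)) * Real.exp (-κ * r) := by
      rw [← Real.exp_add, ← Real.exp_add]; congr 1; ring
    rw [e1, e2]
    field_simp
  have h1 : ∫ r in (0 : ℝ)..t, Real.exp (-κ * (t - r)) *
        (Real.exp (-κ * (t - r.toNNReal)) * ouConv κ (fun q => (q : ℝ) * e) r.toNNReal) =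
      ∫ r in (0 : ℝ)..t, Real.exp (-κ * (t - r)) *
        (Real.exp (-κ * (t - r)) * (e * ((1 - Real.exp (-κ * r)) / κ))) := by
    refine intervalIntegral.integral_congr fun r hr => ?_
    rw [uIcc_of_le ht] at hr
    simp only [Real.coe_toNNReal r hr.1, ouConv_linear hκ e hr.1]
  rw [ouConv, h1, intervalIntegral.integral_eq_sub_of_hasDerivAt hd
    (Continuous.intervalIntegrable (by fun_prop) _ _), Real.coe_toNNReal t ht,
    ouConv_linear hκ e ht]
  have e1 : -κ * (2 * t - t) = -κ * t := by ring
  have e2 : -κ * (2 * t - 0) = -(2 * κ) * t := by ring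
  have e3 : -(2 * κ) * (t - 0) = -(2 * κ) * t := by ring
  rw [e1, e2, e3]
  simp only [sub_self, mul_zero, Real.exp_zero, one_mul]
  field_simp
  ring

lemma sq_intervalIntegral_le {f : ℝ → ℝ} {t : ℝ} (ht : 0 ≤ t) (hf : Continuous f) :
    (∫ r in (0 : ℝ)..t, f r) ^ 2 ≤ t * ∫ r in Ioc (0 : ℝ) t, f r ^ 2 := by
  rcases eq_or_lt_of_le ht with rfl | ht'
  · simp
  set I := ∫ r in (0 : ℝ)..t, f r with hI
  have h0 : 0 ≤ ∫ r in (0 : ℝ)..t, (f r - I / t) ^ 2 :=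
    intervalIntegral.integral_nonneg ht fun r _ => sq_nonneg _
  have h1 : ∫ r in (0 : ℝ)..t, (f r - I / t) ^ 2 =
      (∫ r in (0 : ℝ)..t, f r ^ 2) - 2 * (I / t) * I + t * (I / t) ^ 2 := by
    have : ∀ r, (f r - I / t) ^ 2 = f r ^ 2 - 2 * (I / t) * f r + (I / t) ^ 2 := fun r => by ring
    simp_rw [this]
    rw [intervalIntegral.integral_add (Continuous.intervalIntegrable (by fun_prop) _ _)
        (Continuous.intervalIntegrable (by fun_prop) _ _),
      intervalIntegral.integral_sub (Continuous.intervalIntegrable (by fun_prop) _ _)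
        (Continuous.intervalIntegrable (by fun_prop) _ _), intervalIntegral.integral_const_mul,
      intervalIntegral.integral_const]
    simp [← hI]
  rw [h1] at h0
  rw [← intervalIntegral.integral_of_le ht]
  have h2 : I ^ 2 = t * (2 * (I / t) * I - t * (I / t) ^ 2) := by
    field_simp
    ring
  rw [h2]
  exact mul_le_mul_of_nonneg_left (by linarith) ht

section Convolution

variable {Ω : Type*} {mΩ : MeasurableSpace Ω} {Pr : Measure Ω}
  {ℱ : Filtration ℝ≥0 mΩ}

/-- The features of the real-valued Brownian motion `B(H)` that enter the second moment
computations: a continuous square integrable martingale (tested against past variables) with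
`E[M_t²] = t e`. -/
structure IsBrownianLike (Pr : Measure Ω) (ℱ : Filtration ℝ≥0 mΩ) (M : ℝ≥0 → Ω → ℝ) (e : ℝ) :
    Prop where
  continuous_paths : ∀ ω, Continuous fun t => M t ω
  adapted : ∀ t, Measurable[ℱ t] (M t)
  zero : ∀ ω, M 0 ω = 0
  memLp : ∀ t, MemLp (M t) 2 Pr
  integral_sq : ∀ t : ℝ≥0, ∫ ω, M t ω ^ 2 ∂Pr = t * e
  integral_mul_eq : ∀ s t, s ≤ t → ∀ Z : Ω → ℝ, Measurable[ℱ s] Z → MemLp Z 2 Pr →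
    ∫ ω, M t ω * Z ω ∂Pr = ∫ ω, M s ω * Z ω ∂Pr

variable {M M' : ℝ≥0 → Ω → ℝ} {e e' : ℝ}

lemma IsBrownianLike.measurable_uncurry (hM : IsBrownianLike Pr ℱ M e) :
    Measurable fun p : ℝ × Ω => M p.1.toNNReal p.2 :=
  (measurable_uncurry_of_continuous_of_measurable (u := M) hM.continuous_paths
    fun t => (hM.adapted t).mono (ℱ.le t) le_rfl).comp
    ((continuous_real_toNNReal.measurable.comp measurable_fst).prodMk measurable_snd)

variable [IsProbabilityMeasure Pr]

/-- On `[0,t] × Ω` the integrand of a stochastic convolution is square integrable. -/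
lemma IsBrownianLike.memLp_prod (hM : IsBrownianLike Pr ℱ M e) {k : ℝ → ℝ} (hk : Continuous k)
    (t : ℝ) : MemLp (fun p : ℝ × Ω => k p.1 * M p.1.toNNReal p.2) 2
      ((volume.restrict (Ioc 0 t)).prod Pr) := by
  have hmeas : Measurable fun p : ℝ × Ω => k p.1 * M p.1.toNNReal p.2 :=
    (hk.measurable.comp measurable_fst).mul hM.measurable_uncurry
  rw [memLp_two_iff_integrable_sq hmeas.aestronglyMeasurable,
    integrable_prod_iff (hmeas.pow_const 2).aestronglyMeasurable]
  constructor
  · refine Eventually.of_forall fun r => ?_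
    simp only [mul_pow]
    exact (hM.memLp _).integrable_sq.const_mul _
  · have : ∀ r : ℝ, ∫ ω, ‖(k r * M r.toNNReal ω) ^ 2‖ ∂Pr = k r ^ 2 * (r.toNNReal * e) := by
      intro r
      simp_rw [Real.norm_eq_abs, abs_sq, mul_pow]
      rw [integral_const_mul, hM.integral_sq]
    simp only [this]
    have hc : Continuous fun r : ℝ => k r ^ 2 * ((r.toNNReal : ℝ) * e) := by
      have := continuous_real_toNNReal
      fun_prop
    exact (hc.integrableOn_Icc (a := 0) (b := t)).mono_set Ioc_subset_Icc_self

lemma IsBrownianLike.integrable_prod_mul (hM : IsBrownianLike Pr ℱ M e) {k : ℝ → ℝ}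
    (hk : Continuous k) (t : ℝ) {Z : Ω → ℝ} (hZ : MemLp Z 2 Pr) :
    Integrable (fun p : ℝ × Ω => k p.1 * M p.1.toNNReal p.2 * Z p.2)
      ((volume.restrict (Ioc 0 t)).prod Pr) :=
  (hM.memLp_prod hk t).integrable_mul (hZ.comp_snd _)

lemma IsBrownianLike.intervalIntegrable_integral_mul (hM : IsBrownianLike Pr ℱ M e) {t : ℝ}
    (ht : 0 ≤ t) {Z : Ω → ℝ} (hZ : MemLp Z 2 Pr) :
    IntervalIntegrable (fun r : ℝ => ∫ ω, M r.toNNReal ω * Z ω ∂Pr) volume 0 t := by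
  have := (hM.integrable_prod_mul (k := fun _ => 1) continuous_const t hZ).integral_prod_left
  simp only [one_mul] at this
  rwa [intervalIntegrable_iff_integrableOn_Ioc_of_le ht]

lemma IsBrownianLike.memLp_ouConv (hM : IsBrownianLike Pr ℱ M e) (κ : ℝ) (t : ℝ≥0) :
    MemLp (fun ω => ouConv κ (fun r => M r ω) t) 2 Pr := by
  have ht : (0 : ℝ) ≤ t := t.2
  have hk : Continuous fun r : ℝ => Real.exp (-κ * (t - r)) := by fun_prop
  have hL := hM.memLp_prod hk t
  have hsm : AEStronglyMeasurable
      (fun ω => ∫ r in (0 : ℝ)..t, Real.exp (-κ * (t - r)) * M r.toNNReal ω) Pr := by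
    simp only [intervalIntegral.integral_of_le ht]
    exact hL.aestronglyMeasurable.prod_swap.integral_prod_right'
  have hsq := hL.integrable_sq.integral_prod_right
  -- Cauchy–Schwarz in time: `(∫_0^t f)² ≤ t ∫_0^t f²`.
  have hI : MemLp (fun ω => ∫ r in (0 : ℝ)..t, Real.exp (-κ * (t - r)) * M r.toNNReal ω) 2 Pr := by
    rw [memLp_two_iff_integrable_sq hsm]
    refine (hsq.const_mul (t : ℝ)).mono' (hsm.pow 2) (Eventually.of_forall fun ω => ?_)
    rw [Real.norm_eq_abs, abs_sq]
    exact sq_intervalIntegral_le ht (hk.mul ((hM.continuous_paths ω).comp continuous_real_toNNReal))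
  have h := (hM.memLp t).sub (hI.const_mul κ)
  simp only [ouConv, Real.toNNReal_coe]
  exact h

/-- Expectations pass through stochastic convolutions, by Fubini's theorem. -/
lemma IsBrownianLike.integral_ouConv_mul (hM : IsBrownianLike Pr ℱ M e) (κ : ℝ) (t : ℝ≥0)
    {Z : Ω → ℝ} (hZ : MemLp Z 2 Pr) :
    ∫ ω, ouConv κ (fun r => M r ω) t * Z ω ∂Pr = ouConv κ (fun r => ∫ ω, M r ω * Z ω ∂Pr) t := by
  have ht : (0 : ℝ) ≤ t := t.2
  have hk : Continuous fun r : ℝ => Real.exp (-κ * (t - r)) := by fun_prop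
  have hint := hM.integrable_prod_mul hk t hZ
  have hMZ : Integrable (fun ω => M t ω * Z ω) Pr := (hM.memLp t).integrable_mul hZ
  have h1 : ∀ ω, ouConv κ (fun r => M r ω) t * Z ω = M t ω * Z ω -
      κ * ∫ r in Ioc (0 : ℝ) t, Real.exp (-κ * (t - r)) * M r.toNNReal ω * Z ω := by
    intro ω
    rw [ouConv, Real.toNNReal_coe, intervalIntegral.integral_of_le ht, integral_mul_const]
    ring
  simp_rw [h1]
  rw [integral_sub hMZ (hint.integral_prod_right.const_mul κ), integral_const_mul,
    ← integral_integral_swap (f := fun (r : ℝ) ω =>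
      Real.exp (-κ * (t - r)) * M r.toNNReal ω * Z ω) hint, ouConv, Real.toNNReal_coe,
    intervalIntegral.integral_of_le ht]
  simp_rw [mul_assoc, integral_const_mul]

/-- `E[∫_0^t e^{-κ(t-r)} dM_r Z] = e^{-κ(t-s)} E[∫_0^s e^{-κ(s-r)} dM_r Z]` for `Z` in the past
of `s`. -/
lemma IsBrownianLike.integral_ouConv_mul_past (hM : IsBrownianLike Pr ℱ M e) (κ : ℝ) {s t : ℝ≥0}
    (hst : s ≤ t) {Z : Ω → ℝ} (hZm : Measurable[ℱ s] Z) (hZ : MemLp Z 2 Pr) :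
    ∫ ω, ouConv κ (fun r => M r ω) t * Z ω ∂Pr =
      Real.exp (-κ * (t - s)) * ∫ ω, ouConv κ (fun r => M r ω) s * Z ω ∂Pr := by
  rw [hM.integral_ouConv_mul κ t hZ, hM.integral_ouConv_mul κ s hZ]
  exact ouConv_eq_exp_mul hst (fun r hr => hM.integral_mul_eq s r hr Z hZm hZ)
    (hM.intervalIntegrable_integral_mul s.2 hZ)

/-- A stochastic convolution is uncorrelated with the initial sigma-algebra. -/
lemma IsBrownianLike.integral_ouConv_mul_initial (hM : IsBrownianLike Pr ℱ M e) (κ : ℝ) (t : ℝ≥0)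
    {Z : Ω → ℝ} (hZm : Measurable[ℱ 0] Z) (hZ : MemLp Z 2 Pr) :
    ∫ ω, ouConv κ (fun r => M r ω) t * Z ω ∂Pr = 0 := by
  rw [hM.integral_ouConv_mul_past κ zero_le hZm hZ]
  simp [ouConv, hM.zero]

/-- The covariance of two stochastic convolutions at the same time, as an iterated convolution. -/
lemma IsBrownianLike.integral_ouConv_mul_ouConv (hM : IsBrownianLike Pr ℱ M e)
    (hM' : IsBrownianLike Pr ℱ M' e') {c : ℝ}
    (hc : ∀ t : ℝ≥0, ∫ ω, M t ω * M' t ω ∂Pr = t * c) (κ κ' : ℝ) (t : ℝ≥0) :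
    ∫ ω, ouConv κ (fun r => M r ω) t * ouConv κ' (fun r => M' r ω) t ∂Pr =
      ouConv κ (fun r => Real.exp (-κ' * (t - r)) * ouConv κ' (fun q => (q : ℝ) * c) r) t := by
  rw [hM.integral_ouConv_mul κ t (hM'.memLp_ouConv κ' t)]
  refine ouConv_congr t.2 fun r hr hrt => ?_
  have hrt' : r.toNNReal ≤ t := Real.toNNReal_le_iff_le_coe.mpr hrt
  simp_rw [mul_comm (M _ _)]
  rw [hM'.integral_ouConv_mul_past κ' hrt' (hM.adapted _) (hM.memLp _),
    hM'.integral_ouConv_mul κ' _ (hM.memLp _)]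
  congr 1
  refine ouConv_congr (NNReal.coe_nonneg _) fun q hq hqr => ?_
  have hqr' : q.toNNReal ≤ r.toNNReal := Real.toNNReal_le_iff_le_coe.mpr hqr
  simp_rw [mul_comm (M' _ _)]
  rw [hM.integral_mul_eq _ _ hqr' _ (hM'.adapted _) (hM'.memLp _), hc]

end Convolution

/-! ### The semigroup, Gaussian moments and the Brownian motion -/

/-- `P_t ψ = e^{-aλt} ψ` if `𝔏_W ψ = -λψ`: the function `e^{aλt} P_t ψ` is continuous with right
derivative zero. -/
lemma IsSemigroupOf.apply_eigenfunction {W : StieltjesFunction ℝ} {a : ℝ}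
    {P : ℝ≥0 → L2T →L[ℝ] L2T} (hP : IsSemigroupOf W a P) {ψ : L2T} {l : ℝ}
    (hψ : IsLW W ψ (-l • ψ)) (t : ℝ≥0) : P t ψ = Real.exp (-(a * l) * t) • ψ := by
  have hgen := (hP.generator ψ (a • (-l • ψ))).mpr ⟨_, hψ, rfl⟩
  set v : ℝ → L2T := fun r => P r.toNNReal ψ with hv
  have hvc : Continuous v := (hP.continuous ψ).comp continuous_real_toNNReal
  have hderiv : ∀ r : ℝ, 0 ≤ r → HasDerivWithinAt v (-(a * l) • v r) (Ici r) r := by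
    intro r hr
    rw [← hasDerivWithinAt_Ioi_iff_Ici, hasDerivWithinAt_iff_tendsto_slope' (by simp)]
    have hlim : Tendsto (fun y : ℝ => (y - r).toNNReal) (𝓝[>] r) (𝓝[>] 0) := by
      refine tendsto_nhdsWithin_iff.mpr ⟨?_, ?_⟩
      · have : Continuous fun y : ℝ => (y - r).toNNReal :=
          continuous_real_toNNReal.comp (continuous_id.sub continuous_const)
        simpa using (this.tendsto r).mono_left nhdsWithin_le_nhds
      · filter_upwards [self_mem_nhdsWithin] with y hy
        exact Real.toNNReal_pos.mpr (sub_pos.mpr hy)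
    have h1 := ((P r.toNNReal).continuous.tendsto _).comp (hgen.comp hlim)
    have hval : P r.toNNReal (a • (-l • ψ)) = -(a * l) • v r := by
      rw [smul_smul, map_smul]
      simp [hv]
    rw [hval] at h1
    refine h1.congr' ?_
    filter_upwards [self_mem_nhdsWithin] with y hy
    have hy' : 0 ≤ y - r := sub_nonneg.mpr (le_of_lt hy)
    have hsum : y.toNNReal = r.toNNReal + (y - r).toNNReal := by
      rw [← Real.toNNReal_add hr hy', add_sub_cancel]
    simp only [Function.comp_apply, slope_def_module, hv, hsum, hP.add,
      ContinuousLinearMap.comp_apply, map_smul, map_sub, Real.coe_toNNReal _ hy']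
  have hconst := constant_of_has_deriv_right_zero
    (f := fun r : ℝ => Real.exp (a * l * r) • v r) (a := 0) (b := t)
    (Continuous.continuousOn (by fun_prop)) (fun r hr => by
      have h2 : HasDerivAt (fun r => Real.exp (a * l * r)) (Real.exp (a * l * r) * (a * l)) r := by
        simpa using ((hasDerivAt_id r).const_mul (a * l)).exp
      convert! h2.hasDerivWithinAt.smul (hderiv r hr.1) using 1
      rw [smul_smul, ← add_smul]
      ring_nf
      simp) t ⟨t.2, le_rfl⟩
  simp only [hv, Real.toNNReal_coe, mul_zero, Real.exp_zero, Real.toNNReal_zero, hP.zero,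
    ContinuousLinearMap.id_apply, one_smul] at hconst
  have h3 : Real.exp (-(a * l) * t) • ψ = Real.exp (-(a * l) * t) • Real.exp (a * l * t) • P t ψ := by
    rw [hconst]
  rw [h3, smul_smul, ← Real.exp_add]
  simp

section Gaussian

variable {Ω : Type*} {mΩ : MeasurableSpace Ω} {Pr : Measure Ω} {X : Ω → ℝ} {v : ℝ≥0}

lemma ProbabilityTheory.HasLaw.memLp_two_of_gaussian (h : HasLaw X (gaussianReal 0 v) Pr) :
    MemLp X 2 Pr := by
  have := memLp_id_gaussianReal (μ := 0) (v := v) 2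
  rw [← h.map_eq, memLp_map_measure_iff (by fun_prop) h.aemeasurable] at this
  exact this

lemma ProbabilityTheory.HasLaw.integral_eq_zero_of_gaussian (h : HasLaw X (gaussianReal 0 v) Pr) :
    ∫ ω, X ω ∂Pr = 0 := by
  rw [h.integral_eq, integral_id_gaussianReal]

lemma ProbabilityTheory.HasLaw.integral_sq_of_gaussian (h : HasLaw X (gaussianReal 0 v) Pr) :
    ∫ ω, X ω ^ 2 ∂Pr = v := by
  have h1 := variance_of_integral_eq_zero (μ := gaussianReal 0 v) (X := id) (by fun_prop)
    (integral_id_gaussianReal (μ := 0) (v := v))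
  rw [variance_id_gaussianReal] at h1
  rw [h1]
  exact h.integral_comp (f := fun x => x ^ 2) (by fun_prop)

/-- Polarization of second moments. -/
lemma integral_mul_eq_of_integral_sq {X' : Ω → ℝ} (hX : MemLp X 2 Pr) (hX' : MemLp X' 2 Pr)
    {p q r : ℝ}     (h1 : ∫ ω, X ω ^ 2 ∂Pr = p) (h2 : ∫ ω, X' ω ^ 2 ∂Pr = q)
    (h3 : ∫ ω, (X ω + X' ω) ^ 2 ∂Pr = r) : ∫ ω, X ω * X' ω ∂Pr = (r - p - q) / 2 := by
  have h4 : ∀ ω, (X ω + X' ω) ^ 2 = X ω ^ 2 + X' ω ^ 2 + 2 * (X ω * X' ω) := fun ω => by ring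
  simp_rw [h4] at h3
  have hXX' : Integrable (fun ω => X ω * X' ω) Pr := hX.integrable_mul hX'
  have hsum : Integrable (fun ω => X ω ^ 2 + X' ω ^ 2) Pr := hX.integrable_sq.add hX'.integrable_sq
  rw [integral_add hsum (hXX'.const_mul 2),
    integral_add hX.integrable_sq hX'.integrable_sq, integral_const_mul, h1, h2] at h3
  linarith

end Gaussian

lemma IsLW.add {W : StieltjesFunction ℝ} {F F' g g' : L2T} (h : IsLW W F g) (h' : IsLW W F' g') :
    IsLW W (F + F') (g + g') := by
  obtain ⟨G, hG, hF⟩ := h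
  obtain ⟨G', hG', hF'⟩ := h'
  refine ⟨G + G', hG.add hG', ?_⟩
  filter_upwards [Lp.coeFn_add F F', hF, hF'] with u h1 h2 h3
  rw [h1, Pi.add_apply, Pi.add_apply, h2, h3]

section Brownian

variable {W : StieltjesFunction ℝ} {Ω : Type*} {mΩ : MeasurableSpace Ω} {Pr : Measure Ω}
  {ℱ : Filtration ℝ≥0 mΩ} {B : ℝ≥0 → Ω → testSpace W →ₗ[ℝ] ℝ}

/-- For `H` in the domain of `𝔏_W` the process `B(H)` has quadratic variation
`-t ⟨H, 𝔏_W H⟩`. -/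
lemma IsSWBrownian.isBrownianLike (hW : StrictMono W)
    (hper : ∀ u : ℝ, W (u + 1) - W u = W 1 - W 0) (hB : IsSWBrownian W Pr ℱ B) {H : testSpace W}
    {K : L2T} (hH : IsLW W H K) :
    IsBrownianLike Pr ℱ (fun t ω => B t ω H) (-inner ℝ (H : L2T) K) := by
  obtain ⟨G, hG, hF⟩ := hH
  have hlaw : ∀ t : ℝ≥0, HasLaw (fun ω => B t ω H)
      (gaussianReal 0 ((t : ℝ) * wEnergy W G).toNNReal) Pr := by
    intro t
    simpa [hB.zero] using hB.increments_law 0 t zero_le H G K hG hF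
  have hmem : ∀ t, MemLp (fun ω => B t ω H) 2 Pr := fun t => (hlaw t).memLp_two_of_gaussian
  refine ⟨fun ω => hB.continuous_paths ω H, fun t => hB.adapted t H, fun ω => hB.zero ω H, hmem,
    fun t => ?_, fun s t hst Z hZm hZ => ?_⟩
  · rw [(hlaw t).integral_sq_of_gaussian, ← wEnergy_eq hW hper hG hF]
    exact Real.coe_toNNReal _ (mul_nonneg t.2 (wEnergy_nonneg W G))
  · have hlaw' := hB.increments_law s t hst H G K hG hF
    have hind : IndepFun (fun ω => B t ω H - B s ω H) Z Pr :=
      indep_of_indep_of_le_right (hB.indep_increments s t hst H) hZm.comap_le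
    have h1 := hind.integral_fun_mul_eq_mul_integral
      hlaw'.memLp_two_of_gaussian.aestronglyMeasurable hZ.aestronglyMeasurable
    rw [hlaw'.integral_eq_zero_of_gaussian, zero_mul] at h1
    simp_rw [sub_mul] at h1
    have ht : Integrable (fun ω => B t ω H * Z ω) Pr := (hmem t).integrable_mul hZ
    have hs : Integrable (fun ω => B s ω H * Z ω) Pr := (hmem s).integrable_mul hZ
    rw [integral_sub ht hs] at h1
    exact sub_eq_zero.mp h1

lemma IsSWBrownian.integral_mul (hW : StrictMono W)
    (hper : ∀ u : ℝ, W (u + 1) - W u = W 1 - W 0) (hB : IsSWBrownian W Pr ℱ B)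
    {H H' : testSpace W} {K K' : L2T} (hH : IsLW W H K) (hH' : IsLW W H' K') (t : ℝ≥0) :
    ∫ ω, B t ω H * B t ω H' ∂Pr = t * -inner ℝ (H : L2T) K' := by
  have h1 := hB.isBrownianLike hW hper hH
  have h2 := hB.isBrownianLike hW hper hH'
  have h3 := hB.isBrownianLike (H := H + H') hW hper (hH.add hH')
  have h4 := h3.integral_sq t
  simp only [map_add] at h4
  rw [integral_mul_eq_of_integral_sq (h1.memLp t) (h2.memLp t) (h1.integral_sq t)
    (h2.integral_sq t) h4]
  rw [Submodule.coe_add, inner_add_left, inner_add_right, inner_add_right,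
    hH'.inner_comm hW hper hH]
  ring

end Brownian

/-! ### Covariances for eigenfunctions -/

section OrnsteinUhlenbeck

variable {W : StieltjesFunction ℝ} {a σ χ : ℝ} {Ω : Type*} {mΩ : MeasurableSpace Ω}
  {Pr : Measure Ω} {ℱ : Filtration ℝ≥0 mΩ} {B Y : ℝ≥0 → Ω → testSpace W →ₗ[ℝ] ℝ}

/-- Tested against an eigenfunction, the equation is a scalar Ornstein–Uhlenbeck equation. -/
lemma IsOUSolution.ae_eq_of_eigenfunction (hY : IsOUSolution W a σ Pr ℱ B Y) {ψ : testSpace W}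
    {l : ℝ} (hψ : IsLW W ψ (-l • (ψ : L2T))) :
    ∀ᵐ ω ∂Pr, ∀ t : ℝ≥0, Y t ω ψ =
      Real.exp (-(a * l) * t) * Y 0 ω ψ + σ * ouConv (a * l) (fun r => B r ω ψ) t := by
  filter_upwards [hY.equation ψ (-l • ψ) hψ] with ω hω t
  refine (hY.cadlag_paths ω ψ).eq_exp_mul_add_ouConv (hY.brownian.continuous_paths ω ψ)
    (fun t => ?_) t
  rw [hω t]
  simp only [map_smul, smul_eq_mul, intervalIntegral.integral_const_mul]
  ring

lemma inner_self_eq_integral_sq (f : L2T) : inner ℝ f f = ∫ u in Ico (0 : ℝ) 1, f u ^ 2 := by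
  rw [L2.inner_def]
  simp [sq]

lemma integral_initial_mul (hχ : 0 ≤ χ)
    (hY0 : ∀ H : testSpace W, HasLaw (fun ω => Y 0 ω H)
      (gaussianReal 0 (χ * ∫ u in Ico (0 : ℝ) 1, (H : L2T) u ^ 2).toNNReal) Pr)
    (H H' : testSpace W) :
    ∫ ω, Y 0 ω H * Y 0 ω H' ∂Pr = χ * inner ℝ (H : L2T) (H' : L2T) := by
  have hsq : ∀ H : testSpace W, ∫ ω, Y 0 ω H ^ 2 ∂Pr = χ * inner ℝ (H : L2T) (H : L2T) := by
    intro H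
    rw [(hY0 H).integral_sq_of_gaussian, ← inner_self_eq_integral_sq]
    exact Real.coe_toNNReal _ (mul_nonneg hχ real_inner_self_nonneg)
  have h3 := hsq (H + H')
  simp only [map_add] at h3
  rw [integral_mul_eq_of_integral_sq (hY0 H).memLp_two_of_gaussian
    (hY0 H').memLp_two_of_gaussian (hsq H) (hsq H') h3, Submodule.coe_add, inner_add_left,
    inner_add_right, inner_add_right, real_inner_comm (H : L2T) (H' : L2T)]
  ring

variable [IsProbabilityMeasure Pr]

lemma IsOUSolution.memLp_of_eigenfunction (hW : StrictMono W)
    (hper : ∀ u : ℝ, W (u + 1) - W u = W 1 - W 0) (hY : IsOUSolution W a σ Pr ℱ B Y)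
    {ψ : testSpace W} (hY0 : MemLp (fun ω => Y 0 ω ψ) 2 Pr)
    {l : ℝ} (hψ : IsLW W ψ (-l • (ψ : L2T))) (t : ℝ≥0) : MemLp (fun ω => Y t ω ψ) 2 Pr := by
  have hB := hY.brownian.isBrownianLike hW hper hψ
  refine MemLp.ae_eq ?_ ((hY0.const_mul (Real.exp (-(a * l) * t))).add
    ((hB.memLp_ouConv (a * l) t).const_mul σ))
  filter_upwards [hY.ae_eq_of_eigenfunction hψ] with ω hω
  exact (hω t).symm

/-- `E[Y_t(ψ) Z] = e^{-aλ(t-s)} E[Y_s(ψ) Z]` for `Z` in the past of `s`. -/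
lemma IsOUSolution.integral_mul_past (hW : StrictMono W)
    (hper : ∀ u : ℝ, W (u + 1) - W u = W 1 - W 0) (hY : IsOUSolution W a σ Pr ℱ B Y)
    {ψ : testSpace W} (hY0 : MemLp (fun ω => Y 0 ω ψ) 2 Pr)
    {l : ℝ} (hψ : IsLW W ψ (-l • (ψ : L2T))) {s t : ℝ≥0} (hst : s ≤ t)
    {Z : Ω → ℝ} (hZm : Measurable[ℱ s] Z) (hZ : MemLp Z 2 Pr) :
    ∫ ω, Y t ω ψ * Z ω ∂Pr = Real.exp (-(a * l) * (t - s)) * ∫ ω, Y s ω ψ * Z ω ∂Pr := by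
  have hB := hY.brownian.isBrownianLike hW hper hψ
  have h : ∀ t : ℝ≥0, ∫ ω, Y t ω ψ * Z ω ∂Pr =
      Real.exp (-(a * l) * t) * (∫ ω, Y 0 ω ψ * Z ω ∂Pr) +
        σ * ∫ ω, ouConv (a * l) (fun r => B r ω ψ) t * Z ω ∂Pr := by
    intro t
    have h1 : Integrable (fun ω => Y 0 ω ψ * Z ω) Pr := hY0.integrable_mul hZ
    have h2 : Integrable (fun ω => ouConv (a * l) (fun r => B r ω ψ) t * Z ω) Pr :=
      (hB.memLp_ouConv (a * l) t).integrable_mul hZ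
    rw [← integral_const_mul, ← integral_const_mul,
      ← integral_add (h1.const_mul _) (h2.const_mul _)]
    refine integral_congr_ae ?_
    filter_upwards [hY.ae_eq_of_eigenfunction hψ] with ω hω
    simp only [hω t]
    ring
  rw [h t, h s, hB.integral_ouConv_mul_past (a * l) hst hZm hZ]
  have h1 : Real.exp (-(a * l) * t) =
      Real.exp (-(a * l) * (t - s)) * Real.exp (-(a * l) * s) := by
    rw [← Real.exp_add]
    ring_nf
  rw [h1]
  ring

/-- Stationarity of the covariances of `Y_t(ψ)` for eigenfunctions `ψ`. Two eigenfunctions that are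
not orthogonal have the same eigenvalue, so that the damping `aλ` is balanced by the noise
`σ² λ = 2 χ a λ`. -/
lemma IsOUSolution.integral_mul_self (hW : StrictMono W)
    (hper : ∀ u : ℝ, W (u + 1) - W u = W 1 - W 0) (ha : a ≠ 0) (hχ : 0 ≤ χ)
    (hσ : σ ^ 2 = 2 * χ * a) (hY : IsOUSolution W a σ Pr ℱ B Y)
    (hY0 : ∀ H : testSpace W, HasLaw (fun ω => Y 0 ω H)
      (gaussianReal 0 (χ * ∫ u in Ico (0 : ℝ) 1, (H : L2T) u ^ 2).toNNReal) Pr)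
    {ψ ψ' : testSpace W} {l l' : ℝ} (hψ : IsLW W ψ (-l • (ψ : L2T)))
    (hψ' : IsLW W ψ' (-l' • (ψ' : L2T))) (t : ℝ≥0) :
    ∫ ω, Y t ω ψ * Y t ω ψ' ∂Pr = χ * inner ℝ (ψ : L2T) (ψ' : L2T) := by
  have hB := hY.brownian.isBrownianLike hW hper hψ
  have hB' := hY.brownian.isBrownianLike hW hper hψ'
  have hX := (hY0 ψ).memLp_two_of_gaussian
  have hX' := (hY0 ψ').memLp_two_of_gaussian
  have hN := hB.memLp_ouConv (a * l) t
  have hN' := hB'.memLp_ouConv (a * l') t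
  set E := Real.exp (-(a * l) * t) with hE
  set E' := Real.exp (-(a * l') * t) with hE'
  have hcov : ∀ r : ℝ≥0, ∫ ω, B r ω ψ * B r ω ψ' ∂Pr =
      r * (l' * inner ℝ (ψ : L2T) (ψ' : L2T)) := by
    intro r
    rw [hY.brownian.integral_mul hW hper hψ hψ', inner_smul_right]
    ring
  have h00 := integral_initial_mul hχ hY0 ψ ψ'
  have h01 := hB.integral_ouConv_mul_initial (a * l) t (hY.adapted 0 ψ') hX'
  have h10 := hB'.integral_ouConv_mul_initial (a * l') t (hY.adapted 0 ψ) hX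
  have h11 := hB.integral_ouConv_mul_ouConv hB' hcov (a * l) (a * l') t
  have i00 : Integrable (fun ω => Y 0 ω ψ * Y 0 ω ψ') Pr := hX.integrable_mul hX'
  have i01 : Integrable (fun ω => ouConv (a * l) (fun r => B r ω ψ) t * Y 0 ω ψ') Pr :=
    hN.integrable_mul hX'
  have i10 : Integrable (fun ω => ouConv (a * l') (fun r => B r ω ψ') t * Y 0 ω ψ) Pr :=
    hN'.integrable_mul hX
  have i11 : Integrable (fun ω => ouConv (a * l) (fun r => B r ω ψ) t *
      ouConv (a * l') (fun r => B r ω ψ') t) Pr := hN.integrable_mul hN'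
  have hexpand : ∫ ω, Y t ω ψ * Y t ω ψ' ∂Pr =
      E * E' * (∫ ω, Y 0 ω ψ * Y 0 ω ψ' ∂Pr) +
      σ * E' * (∫ ω, ouConv (a * l) (fun r => B r ω ψ) t * Y 0 ω ψ' ∂Pr) +
      σ * E * (∫ ω, ouConv (a * l') (fun r => B r ω ψ') t * Y 0 ω ψ ∂Pr) +
      σ ^ 2 * ∫ ω, ouConv (a * l) (fun r => B r ω ψ) t *
        ouConv (a * l') (fun r => B r ω ψ') t ∂Pr := by
    have j1 : Integrable (fun ω => E * E' * (Y 0 ω ψ * Y 0 ω ψ') +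
        σ * E' * (ouConv (a * l) (fun r => B r ω ψ) t * Y 0 ω ψ')) Pr :=
      (i00.const_mul _).add (i01.const_mul _)
    have j2 : Integrable (fun ω => E * E' * (Y 0 ω ψ * Y 0 ω ψ') +
        σ * E' * (ouConv (a * l) (fun r => B r ω ψ) t * Y 0 ω ψ') +
        σ * E * (ouConv (a * l') (fun r => B r ω ψ') t * Y 0 ω ψ)) Pr :=
      j1.add (i10.const_mul _)
    simp_rw [← integral_const_mul]
    rw [← integral_add (i00.const_mul _) (i01.const_mul _), ← integral_add j1 (i10.const_mul _),
      ← integral_add j2 (i11.const_mul _)]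
    refine integral_congr_ae ?_
    filter_upwards [hY.ae_eq_of_eigenfunction hψ, hY.ae_eq_of_eigenfunction hψ'] with ω h1 h2
    simp only [h1 t, h2 t, hE, hE']
    ring
  rw [hexpand, h00, h01, h10, h11, hσ]
  have hsymm : l' * inner ℝ (ψ : L2T) (ψ' : L2T) = l * inner ℝ (ψ : L2T) (ψ' : L2T) := by
    have := hψ.inner_comm hW hper hψ'
    rw [inner_smul_right, inner_smul_right, real_inner_comm (ψ : L2T) (ψ' : L2T)] at this
    linarith
  rcases eq_or_ne (inner ℝ (ψ : L2T) (ψ' : L2T)) 0 with h0 | h0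
  · simp [h0, ouConv]
  · have hl : l' = l := mul_right_cancel₀ h0 hsymm
    subst hl
    rcases eq_or_ne l' 0 with rfl | hl
    · simp [hE, hE', ouConv]
    · have hκ : a * l' ≠ 0 := mul_ne_zero ha hl
      have hEE : E * E' = Real.exp (-(2 * (a * l')) * t) := by
        rw [hE, hE', ← Real.exp_add]
        ring_nf
      rw [ouConv_exp_mul_ouConv_linear hκ _ (NNReal.coe_nonneg t), hEE]
      field_simp
      ring

/-- The covariance formula for a pair of eigenfunctions. -/
lemma IsOUSolution.integral_mul_of_eigenfunction (hW : StrictMono W)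
    (hper : ∀ u : ℝ, W (u + 1) - W u = W 1 - W 0) (ha : a ≠ 0) (hχ : 0 ≤ χ)
    (hσ : σ ^ 2 = 2 * χ * a) (hY : IsOUSolution W a σ Pr ℱ B Y)
    (hY0 : ∀ H : testSpace W, HasLaw (fun ω => Y 0 ω H)
      (gaussianReal 0 (χ * ∫ u in Ico (0 : ℝ) 1, (H : L2T) u ^ 2).toNNReal) Pr)
    {P : ℝ≥0 → L2T →L[ℝ] L2T} (hP : IsSemigroupOf W a P)
    {ψ ψ' : testSpace W} {l l' : ℝ} (hψ : IsLW W ψ (-l • (ψ : L2T)))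
    (hψ' : IsLW W ψ' (-l' • (ψ' : L2T))) {s t : ℝ≥0} (hst : s ≤ t) :
    ∫ ω, Y t ω ψ * Y s ω ψ' ∂Pr = χ * inner ℝ (P (t - s) (ψ : L2T)) (ψ' : L2T) := by
  rw [hY.integral_mul_past hW hper (hY0 ψ).memLp_two_of_gaussian hψ hst (hY.adapted s ψ')
      (hY.memLp_of_eigenfunction hW hper (hY0 ψ').memLp_two_of_gaussian hψ' s),
    hY.integral_mul_self hW hper ha hχ hσ hY0 hψ hψ', hP.apply_eigenfunction hψ,
    real_inner_smul_left, NNReal.coe_sub hst]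
  ring

end OrnsteinUhlenbeck

/-! ### Extension to all test functions -/

/-- The span in `S_W(𝕋)` of all eigenfunctions of `𝔏_W` that belong to `S_W(𝕋)`. -/
def eigenSpan (W : StieltjesFunction ℝ) : Submodule ℝ (testSpace W) :=
  Submodule.span ℝ {ψ | ∃ l : ℝ, IsLW W ψ (-l • (ψ : L2T))}

/-- The test functions that are limits of combinations of eigenfunctions, both in `L²(𝕋)` and
under every functional in `S'_W(𝕋)`. -/
def approximable (W : StieltjesFunction ℝ) : Submodule ℝ (testSpace W) where
  carrier := {H | ∃ f : ℕ → testSpace W, (∀ n, f n ∈ eigenSpan W) ∧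
    Tendsto (fun n => (f n : L2T)) atTop (𝓝 H) ∧
    ∀ l, IsBoundedFunctional W l → Tendsto (fun n => l (f n)) atTop (𝓝 (l H))}
  zero_mem' := ⟨fun _ => 0, fun _ => zero_mem _, tendsto_const_nhds, fun _ _ => tendsto_const_nhds⟩
  add_mem' := by
    rintro H H' ⟨f, hf, hf2, hfl⟩ ⟨f', hf', hf2', hfl'⟩
    refine ⟨f + f', fun n => add_mem (hf n) (hf' n), hf2.add hf2', fun l hl => ?_⟩
    simpa using (hfl l hl).add (hfl' l hl)
  smul_mem' := by
    rintro c H ⟨f, hf, hf2, hfl⟩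
    refine ⟨c • f, fun n => Submodule.smul_mem _ _ (hf n), hf2.const_smul c, fun l hl => ?_⟩
    simpa using (hfl l hl).const_mul c

section Eigenbasis

variable {W : StieltjesFunction ℝ} {φ : HilbertBasis ℕ ℝ L2T} {μ : ℕ → ℝ}

lemma smoothSpace_le_testSpace (h : IsEigenbasis W φ μ) : smoothSpace φ μ ≤ testSpace W :=
  le_iSup_of_le φ (le_iSup_of_le μ (le_iSup_of_le h le_rfl))

lemma eigenfunction_mem_smoothSpace (φ : HilbertBasis ℕ ℝ L2T) (μ : ℕ → ℝ) (i : ℕ) :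
    φ i ∈ smoothSpace φ μ := by
  intro n
  refine summable_of_ne_finset_zero (s := {i}) fun k hk => ?_
  have hki : k ≠ i := by simpa using hk
  simp [sobolevTerm, φ.orthonormal.inner_eq_zero hki]

lemma sobolevTerm_nonneg (φ : HilbertBasis ℕ ℝ L2T) (μ : ℕ → ℝ) (n : ℕ) (f : L2T) (k : ℕ) :
    0 ≤ sobolevTerm φ μ n f k :=
  mul_nonneg (mul_nonneg ((even_two_mul n).pow_nonneg _) ((even_two_mul n).pow_nonneg _))
    (sq_nonneg _)

lemma inner_sub_partial_sum (φ : HilbertBasis ℕ ℝ L2T) (f : L2T) (N k : ℕ) :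
    inner ℝ (φ k) (f - ∑ i ∈ Finset.range N, inner ℝ (φ i) f • φ i) =
      if k < N then 0 else inner ℝ (φ k) f := by
  rw [inner_sub_right, inner_sum]
  simp_rw [inner_smul_right, orthonormal_iff_ite.mp φ.orthonormal]
  split_ifs with h
  · simp [h]
  · simp [h]

/-- The eigenfunction expansion of a smooth function converges in every norm `‖·‖ₙ`. -/
lemma tendsto_sobolevNorm_sub_partial_sum {f : L2T} (hf : f ∈ smoothSpace φ μ) (n : ℕ) :
    Tendsto (fun N => sobolevNorm φ μ n (f - ∑ i ∈ Finset.range N, inner ℝ (φ i) f • φ i))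
      atTop (𝓝 0) := by
  have hterm : ∀ N k, sobolevTerm φ μ n (f - ∑ i ∈ Finset.range N, inner ℝ (φ i) f • φ i) k =
      if k < N then 0 else sobolevTerm φ μ n f k := by
    intro N k
    simp only [sobolevTerm, inner_sub_partial_sum]
    split_ifs <;> simp
  have h : Tendsto (fun N => ∑' k,
      sobolevTerm φ μ n (f - ∑ i ∈ Finset.range N, inner ℝ (φ i) f • φ i) k) atTop
      (𝓝 (∑' _ : ℕ, (0 : ℝ))) := by
    refine tendsto_tsum_of_dominated_convergence (hf n) (fun k => ?_)
      (Eventually.of_forall fun N k => ?_)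
    · refine tendsto_const_nhds.congr' ?_
      filter_upwards [eventually_gt_atTop k] with N hN
      rw [hterm, if_pos hN]
    · rw [hterm, Real.norm_eq_abs]
      split_ifs
      · simpa using sobolevTerm_nonneg φ μ n f k
      · rw [abs_of_nonneg (sobolevTerm_nonneg φ μ n f k)]
  simpa [sobolevNorm] using h.sqrt

lemma approximable_eq_top (W : StieltjesFunction ℝ) : approximable W = ⊤ := by
  have h : testSpace W ≤ (approximable W).map (testSpace W).subtype := by
    refine iSup_le fun φ => iSup_le fun μ => iSup_le fun hφ => ?_
    intro x hx
    have hle := smoothSpace_le_testSpace hφ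
    have hmem := fun i => eigenfunction_mem_smoothSpace φ μ i
    set ψ : ℕ → testSpace W := fun i => ⟨φ i, hle (hmem i)⟩ with hψ
    set f : ℕ → testSpace W := fun N => ∑ i ∈ Finset.range N, inner ℝ (φ i) x • ψ i with hf
    have hfc : ∀ N, (f N : L2T) = ∑ i ∈ Finset.range N, inner ℝ (φ i) x • φ i := by
      intro N
      simp [hf, hψ]
    refine ⟨⟨x, hle hx⟩, ⟨f, fun N => ?_, ?_, fun l hl => ?_⟩, rfl⟩
    · exact Submodule.sum_mem _ fun i _ =>
        Submodule.smul_mem _ _ (Submodule.subset_span ⟨μ i, hφ.eigen i⟩)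
    · simp_rw [hfc]
      have := (φ.hasSum_repr x).tendsto_sum_nat
      simpa only [φ.repr_apply_apply] using this
    · obtain ⟨n, C, hC⟩ := hl φ μ hφ
      have hlim := (tendsto_sobolevNorm_sub_partial_sum hx n).const_mul C
      rw [mul_zero] at hlim
      have h0 : Tendsto (fun N => l (⟨x, hle hx⟩ - f N)) atTop (𝓝 0) := by
        refine squeeze_zero_norm (fun N => ?_) hlim
        have hc : ((⟨x, hle hx⟩ - f N : testSpace W) : L2T) =
            x - ∑ i ∈ Finset.range N, inner ℝ (φ i) x • φ i := by
          rw [Submodule.coe_sub, hfc]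
        rw [← hc]
        refine hC _ ?_
        rw [hc]
        exact sub_mem hx (Submodule.sum_mem _ fun i _ => Submodule.smul_mem _ _ (hmem i))
      simp only [map_sub] at h0
      simpa using (tendsto_const_nhds (x := l ⟨x, hle hx⟩)).sub h0
  rw [eq_top_iff]
  intro H _
  obtain ⟨K, hK, hKH⟩ := h H.2
  have : K = H := Subtype.ext hKH
  exact this ▸ hK

end Eigenbasis

section Covariance

variable {W : StieltjesFunction ℝ} {a σ χ : ℝ} {Ω : Type*} {mΩ : MeasurableSpace Ω}
  {Pr : Measure Ω} [IsProbabilityMeasure Pr] {ℱ : Filtration ℝ≥0 mΩ}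
  {B Y : ℝ≥0 → Ω → testSpace W →ₗ[ℝ] ℝ}

lemma IsOUSolution.memLp_of_mem_eigenSpan (hW : StrictMono W)
    (hper : ∀ u : ℝ, W (u + 1) - W u = W 1 - W 0) (hY : IsOUSolution W a σ Pr ℱ B Y)
    (hY0 : ∀ H : testSpace W, MemLp (fun ω => Y 0 ω H) 2 Pr) {f : testSpace W}
    (hf : f ∈ eigenSpan W) (t : ℝ≥0) : MemLp (fun ω => Y t ω f) 2 Pr := by
  induction hf using Submodule.span_induction with
  | mem ψ hψ =>
    obtain ⟨l, hψ⟩ := hψ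
    exact hY.memLp_of_eigenfunction hW hper (hY0 ψ) hψ t
  | zero => simp
  | add f g _ _ hf hg =>
    simp only [map_add]
    exact hf.add hg
  | smul c f _ hf =>
    simp only [map_smul, smul_eq_mul]
    exact hf.const_mul c

/-- The covariance formula on the span of the eigenfunctions, by bilinearity. -/
lemma IsOUSolution.integral_mul_of_mem_eigenSpan (hW : StrictMono W)
    (hper : ∀ u : ℝ, W (u + 1) - W u = W 1 - W 0) (ha : a ≠ 0) (hχ : 0 ≤ χ)
    (hσ : σ ^ 2 = 2 * χ * a) (hY : IsOUSolution W a σ Pr ℱ B Y)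
    (hY0 : ∀ H : testSpace W, HasLaw (fun ω => Y 0 ω H)
      (gaussianReal 0 (χ * ∫ u in Ico (0 : ℝ) 1, (H : L2T) u ^ 2).toNNReal) Pr)
    {P : ℝ≥0 → L2T →L[ℝ] L2T} (hP : IsSemigroupOf W a P) {f g : testSpace W}
    (hf : f ∈ eigenSpan W) (hg : g ∈ eigenSpan W) {s t : ℝ≥0} (hst : s ≤ t) :
    ∫ ω, Y t ω f * Y s ω g ∂Pr = χ * inner ℝ (P (t - s) (f : L2T)) (g : L2T) := by
  have hmem : ∀ {h : testSpace W}, h ∈ eigenSpan W → ∀ t, MemLp (fun ω => Y t ω h) 2 Pr :=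
    fun hh t => hY.memLp_of_mem_eigenSpan hW hper (fun H => (hY0 H).memLp_two_of_gaussian) hh t
  have hint : ∀ {h k : testSpace W}, h ∈ eigenSpan W → k ∈ eigenSpan W →
      Integrable (fun ω => Y t ω h * Y s ω k) Pr :=
    fun hh hk => (hmem hh t).integrable_mul (hmem hk s)
  induction hf, hg using Submodule.span_induction₂ with
  | mem_mem ψ ψ' hψ hψ' =>
    obtain ⟨l, hψ⟩ := hψ
    obtain ⟨l', hψ'⟩ := hψ'
    exact hY.integral_mul_of_eigenfunction hW hper ha hχ hσ hY0 hP hψ hψ' hst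
  | zero_left => simp
  | zero_right => simp
  | add_left f f' g hf hf' hg h h' =>
    simp only [map_add, add_mul, Submodule.coe_add, inner_add_left]
    rw [integral_add (hint hf hg) (hint hf' hg), h, h', mul_add]
  | add_right f g g' hf hg hg' h h' =>
    simp only [map_add, mul_add, Submodule.coe_add, inner_add_right]
    rw [integral_add (hint hf hg) (hint hf hg'), h, h']
  | smul_left c f g hf hg h =>
    simp only [map_smul, smul_eq_mul, mul_assoc, Submodule.coe_smul, real_inner_smul_left]
    rw [integral_const_mul, h]
    ring
  | smul_right c f g hf hg h =>
    simp only [map_smul, smul_eq_mul, mul_left_comm _ c, Submodule.coe_smul, real_inner_smul_right]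
    rw [integral_const_mul, h]

/-- `‖Y_t(H)‖_{L²} ≤ √χ ‖H‖_{L²}`, by Fatou's lemma from the case of eigenfunction combinations. -/
lemma IsOUSolution.eLpNorm_le (hW : StrictMono W)
    (hper : ∀ u : ℝ, W (u + 1) - W u = W 1 - W 0) (ha : a ≠ 0) (hχ : 0 ≤ χ)
    (hσ : σ ^ 2 = 2 * χ * a) (hY : IsOUSolution W a σ Pr ℱ B Y)
    (hY0 : ∀ H : testSpace W, HasLaw (fun ω => Y 0 ω H)
      (gaussianReal 0 (χ * ∫ u in Ico (0 : ℝ) 1, (H : L2T) u ^ 2).toNNReal) Pr)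
    {P : ℝ≥0 → L2T →L[ℝ] L2T} (hP : IsSemigroupOf W a P) (H : testSpace W) (t : ℝ≥0) :
    eLpNorm (fun ω => Y t ω H) 2 Pr ≤ ENNReal.ofReal (Real.sqrt χ * ‖(H : L2T)‖) := by
  obtain ⟨f, hf, hfH, hfl⟩ : H ∈ approximable W := approximable_eq_top W ▸ Submodule.mem_top
  have hm : ∀ H, Measurable fun ω => Y t ω H := fun H => (hY.adapted t H).mono (ℱ.le t) le_rfl
  have hnorm : ∀ n, eLpNorm (fun ω => Y t ω (f n)) 2 Pr =
      ENNReal.ofReal (Real.sqrt χ * ‖(f n : L2T)‖) := by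
    intro n
    have hL := hY.memLp_of_mem_eigenSpan hW hper (fun H => (hY0 H).memLp_two_of_gaussian) (hf n) t
    have h1 := hY.integral_mul_of_mem_eigenSpan hW hper ha hχ hσ hY0 hP (hf n) (hf n)
      (le_refl t)
    rw [tsub_self, hP.zero, ContinuousLinearMap.id_apply, real_inner_self_eq_norm_sq] at h1
    have h2 : ‖hL.toLp‖ ^ 2 = χ * ‖(f n : L2T)‖ ^ 2 := by
      rw [← h1, ← real_inner_self_eq_norm_sq, L2.inner_def]
      refine integral_congr_ae ?_
      filter_upwards [hL.coeFn_toLp] with ω hω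
      simp [hω, sq]
    rw [← ENNReal.ofReal_toReal hL.2.ne, ← Lp.norm_toLp _ hL]
    congr 1
    rw [← Real.sqrt_sq (norm_nonneg hL.toLp), h2, Real.sqrt_mul hχ, Real.sqrt_sq (norm_nonneg _)]
  refine (Lp.eLpNorm_lim_le_liminf_eLpNorm (fun n => (hm (f n)).aestronglyMeasurable) _
    (Eventually.of_forall fun ω => hfl _ (hY.bounded t ω))).trans ?_
  simp_rw [hnorm]
  have hlim : Tendsto (fun n => ENNReal.ofReal (Real.sqrt χ * ‖(f n : L2T)‖)) atTop
      (𝓝 (ENNReal.ofReal (Real.sqrt χ * ‖(H : L2T)‖))) :=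
    ENNReal.tendsto_ofReal (hfH.norm.const_mul _)
  exact hlim.liminf_eq.le

/-- The covariance formula for all test functions: both sides are continuous along a sequence of
eigenfunction combinations that converges to `H`. -/
theorem IsOUSolution.integral_mul (hW : StrictMono W)
    (hper : ∀ u : ℝ, W (u + 1) - W u = W 1 - W 0) (ha : a ≠ 0) (hχ : 0 ≤ χ)
    (hσ : σ ^ 2 = 2 * χ * a) (hY : IsOUSolution W a σ Pr ℱ B Y)
    (hY0 : ∀ H : testSpace W, HasLaw (fun ω => Y 0 ω H)
      (gaussianReal 0 (χ * ∫ u in Ico (0 : ℝ) 1, (H : L2T) u ^ 2).toNNReal) Pr)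
    {P : ℝ≥0 → L2T →L[ℝ] L2T} (hP : IsSemigroupOf W a P) (H : testSpace W) {s t : ℝ≥0}
    (hst : s ≤ t) :
    Integrable (fun ω => Y t ω H * Y s ω H) Pr ∧
      ∫ ω, Y t ω H * Y s ω H ∂Pr = χ * inner ℝ (P (t - s) (H : L2T)) (H : L2T) := by
  have hle := fun K r => hY.eLpNorm_le hW hper ha hχ hσ hY0 hP K r
  have hmem : ∀ r (K : testSpace W), MemLp (fun ω => Y r ω K) 2 Pr := fun r K =>
    ⟨((hY.adapted r K).mono (ℱ.le r) le_rfl).aestronglyMeasurable,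
      (hle K r).trans_lt ENNReal.ofReal_lt_top⟩
  refine ⟨(hmem t H).integrable_mul (hmem s H), ?_⟩
  have hinner : ∀ K : testSpace W, inner ℝ (hmem t K).toLp (hmem s K).toLp =
      ∫ ω, Y t ω K * Y s ω K ∂Pr := by
    intro K
    rw [L2.inner_def]
    refine integral_congr_ae ?_
    filter_upwards [(hmem t K).coeFn_toLp, (hmem s K).coeFn_toLp] with ω h1 h2
    simp [h1, h2, mul_comm]
  obtain ⟨f, hf, hfH, -⟩ : H ∈ approximable W := approximable_eq_top W ▸ Submodule.mem_top
  have hlim : ∀ r, Tendsto (fun n => (hmem r (f n)).toLp) atTop (𝓝 (hmem r H).toLp) := by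
    intro r
    rw [tendsto_iff_norm_sub_tendsto_zero]
    have h0 : Tendsto (fun n => Real.sqrt χ * ‖(f n : L2T) - H‖) atTop (𝓝 0) := by
      simpa using (tendsto_iff_norm_sub_tendsto_zero.mp hfH).const_mul (Real.sqrt χ)
    refine squeeze_zero (fun _ => norm_nonneg _) (fun n => ?_) h0
    rw [← MemLp.toLp_sub, Lp.norm_toLp]
    refine ENNReal.toReal_le_of_le_ofReal (by positivity) ?_
    have := hle (f n - H) r
    simp only [map_sub, Submodule.coe_sub] at this
    exact this
  have h1 := (hlim t).inner (𝕜 := ℝ) (hlim s)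
  have h2 : Tendsto (fun n => χ * inner ℝ (P (t - s) (f n : L2T)) (f n : L2T)) atTop
      (𝓝 (χ * inner ℝ (P (t - s) (H : L2T)) (H : L2T))) :=
    ((((P (t - s)).continuous.tendsto _).comp hfH).inner hfH).const_mul χ
  rw [hinner] at h1
  refine tendsto_nhds_unique (h1.congr fun n => ?_) h2
  rw [hinner]
  exact hY.integral_mul_of_mem_eigenSpan hW hper ha hχ hσ hY0 hP (hf n) (hf n) hst

end Covariance

end

theorem lemma6p1
    (W : StieltjesFunction ℝ) (hW : StrictMono W)
    (hper : ∀ u : ℝ, W (u + 1) - W u = W 1 - W 0)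
    (b ρ : ℝ) (hb : -(1 / 2) < b) (hρ : ρ ∈ Icc (0 : ℝ) 1)
    {Ω : Type*} {mΩ : MeasurableSpace Ω} (Pr : Measure Ω) [IsProbabilityMeasure Pr]
    (ℱ : Filtration ℝ≥0 mΩ) (B Y : ℝ≥0 → Ω → testSpace W →ₗ[ℝ] ℝ)
    (hY : IsOUSolution W (1 + 2 * b * ρ)
      (Real.sqrt (2 * (ρ * (1 - ρ)) * (1 + 2 * b * ρ))) Pr ℱ B Y)
    (hY0 : ∀ H : testSpace W,
      HasLaw (fun ω => Y 0 ω H)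
        (gaussianReal 0 (ρ * (1 - ρ) * ∫ u in Ico (0 : ℝ) 1, (H : L2T) u ^ 2).toNNReal) Pr)
    (P : ℝ≥0 → L2T →L[ℝ] L2T) (hP : IsSemigroupOf W (1 + 2 * b * ρ) P)
    (H : testSpace W) (s t : ℝ≥0) (hst : s ≤ t) :
    Integrable (fun ω => Y t ω H * Y s ω H) Pr ∧
      ∫ ω, Y t ω H * Y s ω H ∂Pr =
        ρ * (1 - ρ) * ∫ u in Ico (0 : ℝ) 1, (P (t - s) (H : L2T)) u * (H : L2T) u := by
  have ha : 0 < 1 + 2 * b * ρ := by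
    rcases eq_or_lt_of_le hρ.1 with h0 | h0
    · simp [← h0]
    · nlinarith [hρ.2]
  have hχ : 0 ≤ ρ * (1 - ρ) := mul_nonneg hρ.1 (sub_nonneg.mpr hρ.2)
  have hσ := Real.sq_sqrt (mul_nonneg (mul_nonneg zero_le_two hχ) ha.le)
  have h := hY.integral_mul hW hper ha.ne' hχ hσ hY0 hP H hst
  rw [real_inner_comm, L2.inner_def] at h
  simpa using h
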